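/- Let $\Omega\subset\mathbb{R}^3$ be a bounded open set, let $A\in C^\infty(\overline{\Omega};\mathbb{R}^3)$ and $q\in C^\infty(\overline{\Omega};\mathbb{C})$, and let $\varphi$ be a limiting Carleman weight near $\overline{\Omega}$; that is, $\varphi$ is a real-valued $C^\infty$ function in an open neighbourhood $U$ of $\overline{\Omega}$ with $\nabla\varphi\neq 0$ in $U$, and for all $x \in U$, $\xi\in\mathbb{R}^3$ the symbols $a(x,\xi)=|\xi|^2-|\nabla\varphi(x)|^2$ and $b(x,\xi)=2\nabla\varphi(x)\cdot\xi$ satisfy $$\{a,b\}(x,\xi)=(\nabla_\xi a\cdot\nabla_x b-\nabla_x a\cdot\nabla_\xi b)(x,\xi)=0\quad\text{whenever } a(x,\xi)=b(x,\xi)=0 .$$ Let $D=-i\nabla$, let $\sigma=(\sigma_1,\sigma_2,\sigma_3)$ be the vector of Pauli matrices $$\sigma_1=\begin{pmatrix}0&1\\1&0\end{pmatrix},\quad \sigma_2=\begin{pmatrix}0&-i\\i&0\end{pmatrix},\quad \sigma_3=\begin{pmatrix}1&0\\0&-1\end{pmatrix},$$ and let $\|\cdot\|$ be the norm of $L^2(\Omega;\mathbb{C}^2)$.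 Let $C_0>0$, and for $0<\alpha<1$ and $0<h<1$ put $$\varepsilon(h)=\bigl(C_0\,|\log h^{\alpha}|\bigr)^{-1},\qquad \tilde\varphi=\varphi+\frac{h}{\varepsilon(h)}\,\frac{\varphi^2}{2}.$$ Then there is a constant $C>0$, independent of $\alpha$, such that for every $\alpha\in(0,1)$ there is $h_0>0$ such that for all $0<h\le h_0$ $$\|e^{\tilde\varphi/h}u\|^2\le C\,\varepsilon(h)\,\|e^{\tilde\varphi/h}(\sigma\cdot(D+A)+qI_2)u\|^2\qquad\text{for all } u\in H^1_0(\Omega)^2 ,$$ where the derivatives of $u$ are weak derivatives and $H^1_0(\Omega)$ is the closure of $C_c^\infty(\Omega)$ in $H^1(\Omega)$. -/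

import Mathlib

open MeasureTheory
open scoped ContDiff Gradient ENNReal

noncomputable section

namespace PauliDirac

/-- Euclidean three-space. -/
abbrev E3 : Type := EuclideanSpace ℝ (Fin 3)

/-- `ℂ²` with its Hermitian norm. -/
abbrev Spinor : Type := EuclideanSpace ℂ (Fin 2)

/-- The `j`-th standard basis vector of `ℝ³`. -/
def basisVec (j : Fin 3) : E3 := EuclideanSpace.single j 1

/-- The classical partial derivative `∂_j f (x)`. -/
def partialDeriv {F : Type*} [NormedAddCommGroup F] [NormedSpace ℝ F]
    (j : Fin 3) (f : E3 → F) (x : E3) : F :=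
  fderiv ℝ f x (basisVec j)

/-! ### Limiting Carleman weights -/

/-- The Poisson bracket `{a, b} = ∇_ξ a · ∇_x b - ∇_x a · ∇_ξ b` of two symbols on `ℝ³ × ℝ³`. -/
def poissonBracket (a b : E3 → E3 → ℝ) (x ξ : E3) : ℝ :=
  ∑ j : Fin 3,
    (partialDeriv j (fun η => a x η) ξ * partialDeriv j (fun y => b y ξ) x
      - partialDeriv j (fun y => a y ξ) x * partialDeriv j (fun η => b x η) ξ)

/-- Real part `|ξ|² - |∇φ|²` of the principal symbol of `e^{φ/h} (-h²Δ) e^{-φ/h}`. -/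
def symbolRe (φ : E3 → ℝ) (x ξ : E3) : ℝ := ‖ξ‖ ^ 2 - ‖∇ φ x‖ ^ 2

/-- Imaginary part `2 ∇φ · ξ` of the principal symbol of `e^{φ/h} (-h²Δ) e^{-φ/h}`. -/
def symbolIm (φ : E3 → ℝ) (x ξ : E3) : ℝ := 2 * inner ℝ (∇ φ x) ξ

/-- `φ` is a limiting Carleman weight (for the Laplacian) in the open set `U`. -/
structure IsLimitingCarlemanWeight (U : Set E3) (φ : E3 → ℝ) : Prop where
  smooth : ContDiffOn ℝ ∞ φ U
  gradient_ne_zero : ∀ x ∈ U, ∇ φ x ≠ 0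
  bracket_eq_zero : ∀ x ∈ U, ∀ ξ : E3, symbolRe φ x ξ = 0 → symbolIm φ x ξ = 0 →
    poissonBracket (symbolRe φ) (symbolIm φ) x ξ = 0

/-- `φ` is a limiting Carleman weight in some open neighbourhood of `K`. -/
def IsLimitingCarlemanWeightNear (K : Set E3) (φ : E3 → ℝ) : Prop :=
  ∃ U : Set E3, IsOpen U ∧ K ⊆ U ∧ IsLimitingCarlemanWeight U φ

/-- `ε(h) = (C₀ |log h^α|)⁻¹`. -/
def epsilon (C₀ α h : ℝ) : ℝ := (C₀ * |Real.log (h ^ α)|)⁻¹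

/-- The convexified weight `φ̃ = φ + (h / ε(h)) φ² / 2`. -/
def convexifiedWeight (φ : E3 → ℝ) (C₀ α h : ℝ) (x : E3) : ℝ :=
  φ x + h / epsilon C₀ α h * (φ x ^ 2 / 2)

/-! ### Sobolev spaces -/

/-- `ψ ∈ C_c^∞(Ω; F)`. -/
structure IsTestFunction {F : Type*} [NormedAddCommGroup F] [NormedSpace ℝ F]
    (Ω : Set E3) (ψ : E3 → F) : Prop where
  smooth : ContDiff ℝ ∞ ψ
  compactSupport : HasCompactSupport ψ
  tsupport_subset : tsupport ψ ⊆ Ω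

/-- `g` is the weak partial derivative `∂_j u` in the open set `Ω`. -/
structure IsWeakPartialDeriv {F : Type*} [NormedAddCommGroup F] [NormedSpace ℝ F]
    (Ω : Set E3) (j : Fin 3) (u g : E3 → F) : Prop where
  locallyIntegrable : LocallyIntegrableOn u Ω
  locallyIntegrable_deriv : LocallyIntegrableOn g Ω
  integral_eq : ∀ ψ : E3 → ℝ, IsTestFunction Ω ψ →
    ∫ x in Ω, partialDeriv j ψ x • u x = -∫ x in Ω, ψ x • g x

/-- `u ∈ H¹₀(Ω; F)`: `u` lies in `H¹(Ω; F)` (it and its weak partial derivatives are in `L²(Ω)`)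
and is a limit in the `H¹` norm of functions in `C_c^∞(Ω; F)`. -/
def MemH10 {F : Type*} [NormedAddCommGroup F] [NormedSpace ℝ F]
    (Ω : Set E3) (u : E3 → F) : Prop :=
  MemLp u 2 (volume.restrict Ω) ∧
  ∃ g : Fin 3 → E3 → F,
    (∀ j, MemLp (g j) 2 (volume.restrict Ω) ∧ IsWeakPartialDeriv Ω j u (g j)) ∧
    ∀ δ : ℝ≥0∞, 0 < δ → ∃ ψ : E3 → F, IsTestFunction Ω ψ ∧
      eLpNorm (fun x => u x - ψ x) 2 (volume.restrict Ω) ≤ δ ∧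
      ∀ j, eLpNorm (fun x => g j x - partialDeriv j ψ x) 2 (volume.restrict Ω) ≤ δ

/-! ### The Pauli–Dirac operator -/

/-- The Pauli matrices `σ₁, σ₂, σ₃`. -/
def pauli : Fin 3 → Matrix (Fin 2) (Fin 2) ℂ :=
  ![!![0, 1; 1, 0], !![0, -Complex.I; Complex.I, 0], !![1, 0; 0, -1]]

/-- The value at `x` of `(σ · (D + A) + q I₂) u`, with `D = -i∇`, where `du j` is the
(weak) partial derivative `∂_j u`. -/
def pauliDirac (A : E3 → E3) (q : E3 → ℂ) (u : E3 → Spinor) (du : Fin 3 → E3 → Spinor)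
    (x : E3) : Spinor :=
  (∑ j : Fin 3,
    Matrix.toEuclideanLin (pauli j) ((-Complex.I) • du j x + ((A x j : ℝ) : ℂ) • u x))
    + q x • u x

end PauliDirac

end

/-! The estimate is first proved for the free Dirac operator on test functions. Set `a = ∇φ /
|∇φ|²`. The bracket condition fixes the Hessian of `φ` on the plane orthogonal to `∇φ`, and this
says exactly what is needed for the Jacobian of `a` to be a multiple of the identity plus a skew
matrix (`IsLimitingCarlemanWeight.isConformalField`).

Write `e_j = iσ_j`. Clifford multiplication by `a` turns `e · ∇` into `-(a · ∇ + e · (a × ∇))`.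
Since `a · ∇φ = 1` and `a × ∇φ = 0`, conjugating by `exp (tφ + κφ²/2)` only adds the scalar `f = -(t
+ κφ)` to `a · ∇ + e · (a × ∇)` (`conjugatedDirac_exp`). With `X = a · ∇v` and `B = e · (a × ∇)v + f
v`, expand `‖X + B‖² = ‖X‖² + ‖B‖² + 2⟨X, B⟩`. Because `a` is conformal and `a · ∇f = -κ`, the cross
term is, modulo divergences, `κ‖v‖²` plus errors of size `‖v‖‖X‖`, `‖v‖‖B‖` and `‖v‖²`
(`IsCliffordTriple.cross_term_identity`). Completing squares absorbs them, leaving `(κ - N)‖v‖²`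
with `N` independent of `t` and `κ` (`IsCliffordTriple.carleman_estimate`).

For the theorem take `t = 1/h` and `κ = 1/ε(h)`. Density carries the bound to `H¹₀`
(`MemH10.weighted_dirac_estimate`), and the bounded potential is absorbed once `κ` is large
(`absorb_le`). Only this threshold on `κ`, hence `h₀`, involves `α`. -/

noncomputable section

namespace PauliDirac

/-! ### Calculus of partial derivatives. -/

section Calculus

variable {F : Type*} [NormedAddCommGroup F] [NormedSpace ℝ F]

theorem _root_.ContDiff.partialDeriv {f : E3 → F} (hf : ContDiff ℝ ∞ f) (j : Fin 3) :
    ContDiff ℝ ∞ (partialDeriv j f) :=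
  (hf.fderiv_right (m := ∞) le_rfl).clm_apply contDiff_const

theorem _root_.ContDiff.differentiableAt_of_smooth {f : E3 → F} (hf : ContDiff ℝ ∞ f) {x : E3} :
    DifferentiableAt ℝ f x :=
  hf.differentiable (by simp) x

theorem tsupport_partialDeriv_subset (j : Fin 3) (f : E3 → F) :
    tsupport (partialDeriv j f) ⊆ tsupport f :=
  tsupport_fderiv_apply_subset ℝ (basisVec j)

theorem _root_.HasCompactSupport.partialDeriv {f : E3 → F} (hf : HasCompactSupport f)
    (j : Fin 3) : HasCompactSupport (partialDeriv j f) :=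
  hf.fderiv_apply ℝ (basisVec j)

theorem partialDeriv_mul (j : Fin 3) {f g : E3 → ℝ} {x : E3}
    (hf : DifferentiableAt ℝ f x) (hg : DifferentiableAt ℝ g x) :
    partialDeriv j (fun y => f y * g y) x
      = f x * partialDeriv j g x + partialDeriv j f x * g x := by
  simp only [partialDeriv]
  rw [fderiv_fun_mul hf hg]
  simp [mul_comm]

theorem partialDeriv_smul (j : Fin 3) {f : E3 → ℝ} {g : E3 → F} {x : E3}
    (hf : DifferentiableAt ℝ f x) (hg : DifferentiableAt ℝ g x) :
    partialDeriv j (fun y => f y • g y) x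
      = f x • partialDeriv j g x + partialDeriv j f x • g x := by
  simp only [partialDeriv]
  rw [fderiv_fun_smul hf hg]
  simp

theorem _root_.Filter.EventuallyEq.partialDeriv_eq {f g : E3 → F} {x : E3}
    (h : f =ᶠ[nhds x] g) (j : Fin 3) : partialDeriv j f x = partialDeriv j g x := by
  simp only [partialDeriv, h.fderiv_eq]

theorem partialDeriv_comm {f : E3 → F} (hf : ContDiff ℝ ∞ f) (j k : Fin 3) (x : E3) :
    partialDeriv j (partialDeriv k f) x = partialDeriv k (partialDeriv j f) x := by
  have hd : DifferentiableAt ℝ (fderiv ℝ f) x :=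
    ((hf.fderiv_right (m := ∞) le_rfl).differentiable (by simp)) x
  have key : ∀ i l : Fin 3, partialDeriv i (partialDeriv l f) x
      = fderiv ℝ (fderiv ℝ f) x (basisVec i) (basisVec l) := by
    intro i l
    have : partialDeriv l f = fun y => fderiv ℝ f y (basisVec l) := rfl
    rw [this]
    simp only [partialDeriv]
    rw [fderiv_clm_apply hd (differentiableAt_const _)]
    simp
  rw [key, key]
  exact (hf.contDiffAt.isSymmSndFDerivAt
    (by simpa using WithTop.coe_le_coe.2 (le_top : (2 : ℕ∞) ≤ ⊤))) _ _

theorem eq_zero_of_notMem_tsupport {f : E3 → F} {x : E3} (hx : x ∉ tsupport f) :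
    f x = 0 ∧ ∀ j, partialDeriv j f x = 0 :=
  ⟨image_eq_zero_of_notMem_tsupport hx, fun j =>
    image_eq_zero_of_notMem_tsupport fun h => hx (tsupport_partialDeriv_subset j f h)⟩

end Calculus

/-! ### Divergence terms and integration by parts. -/

section ZeroIntegral

/-- The function `G` is integrable on `ℝ³` and has integral zero. -/
def HasZeroIntegral (G : E3 → ℝ) : Prop := Integrable G ∧ ∫ x, G x = 0

theorem HasZeroIntegral.add {f g : E3 → ℝ} (hf : HasZeroIntegral f) (hg : HasZeroIntegral g) :
    HasZeroIntegral fun x => f x + g x :=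
  ⟨hf.1.add hg.1, by rw [integral_add hf.1 hg.1, hf.2, hg.2, add_zero]⟩

theorem HasZeroIntegral.sub {f g : E3 → ℝ} (hf : HasZeroIntegral f) (hg : HasZeroIntegral g) :
    HasZeroIntegral fun x => f x - g x :=
  ⟨hf.1.sub hg.1, by rw [integral_sub hf.1 hg.1, hf.2, hg.2, sub_zero]⟩

theorem HasZeroIntegral.sum {ι : Type*} {s : Finset ι} {f : ι → E3 → ℝ}
    (hf : ∀ i ∈ s, HasZeroIntegral (f i)) : HasZeroIntegral fun x => ∑ i ∈ s, f i x :=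
  ⟨integrable_finsetSum _ fun i hi => (hf i hi).1, by
    rw [integral_finsetSum _ fun i hi => (hf i hi).1]
    exact Finset.sum_eq_zero fun i hi => (hf i hi).2⟩

theorem hasZeroIntegral_partialDeriv {g : E3 → ℝ} (hg : ContDiff ℝ ∞ g)
    (hc : HasCompactSupport g) (k : Fin 3) : HasZeroIntegral (partialDeriv k g) := by
  have hi : Integrable (partialDeriv k g) :=
    (hg.partialDeriv k).continuous.integrable_of_hasCompactSupport (hc.partialDeriv k)
  refine ⟨hi, ?_⟩
  have h := integral_mul_fderiv_eq_neg_fderiv_mul_of_integrable (μ := (volume : Measure E3))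
    (f := fun _ : E3 => (1 : ℝ)) (g := g) (v := basisVec k) (by simp)
    (by simp only [one_mul]; exact hi)
    (by simpa using hg.continuous.integrable_of_hasCompactSupport hc)
    (fun _ _ => differentiableAt_const _) (fun x _ => hg.differentiable (by simp) x)
  simp only [one_mul, fderiv_fun_const, Pi.zero_apply, zero_apply, zero_mul, integral_zero,
    neg_zero] at h
  exact h

variable {V : Type*} [NormedAddCommGroup V] [InnerProductSpace ℝ V]

theorem partialDeriv_mul_inner (j : Fin 3) {c : E3 → ℝ} {v w : E3 → V} (E : V →L[ℝ] V) {x : E3}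
    (hc : DifferentiableAt ℝ c x) (hv : DifferentiableAt ℝ v x) (hw : DifferentiableAt ℝ w x) :
    partialDeriv j (fun y => c y * inner ℝ (v y) (E (w y))) x
      = c x * (inner ℝ (partialDeriv j v x) (E (w x)) + inner ℝ (v x) (E (partialDeriv j w x)))
        + partialDeriv j c x * inner ℝ (v x) (E (w x)) := by
  have hEw : DifferentiableAt ℝ (fun y => E (w y)) x := E.differentiableAt.comp x hw
  rw [partialDeriv_mul j hc (hv.inner ℝ hEw)]
  have h1 : partialDeriv j (fun y => inner ℝ (v y) (E (w y))) x
      = inner ℝ (partialDeriv j v x) (E (w x)) + inner ℝ (v x) (E (partialDeriv j w x)) := by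
    simp only [partialDeriv]
    rw [fderiv_inner_apply ℝ hv hEw]
    have : fderiv ℝ (fun y => E (w y)) x = E.comp (fderiv ℝ w x) := E.hasFDerivAt.comp x
      hw.hasFDerivAt |>.fderiv
    rw [this, add_comm]
    rfl
  rw [h1]

theorem contDiff_mul_inner {c : E3 → ℝ} {v w : E3 → V} (E : V →L[ℝ] V)
    (hc : ContDiff ℝ ∞ c) (hv : ContDiff ℝ ∞ v) (hw : ContDiff ℝ ∞ w) :
    ContDiff ℝ ∞ fun y => c y * inner ℝ (v y) (E (w y)) :=
  hc.mul (hv.inner ℝ (E.contDiff.comp hw))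

theorem hasCompactSupport_mul_inner {c : E3 → ℝ} {v w : E3 → V} (E : V →L[ℝ] V)
    (hv : HasCompactSupport v) :
    HasCompactSupport fun y => c y * inner ℝ (v y) (E (w y)) :=
  hv.mono fun x hx => by
    contrapose! hx
    simp [Function.notMem_support.1 hx]

/-- Integration by parts for a quadratic form in the gradient with a skew coefficient. -/
theorem hasZeroIntegral_skew {c : E3 → ℝ} {v : E3 → V} (E : V →L[ℝ] V)
    (hE : ∀ y z, inner ℝ (E y) z = -inner ℝ y (E z))
    (hc : ContDiff ℝ ∞ c) (hv : ContDiff ℝ ∞ v) (hs : HasCompactSupport v) (j k : Fin 3) :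
    HasZeroIntegral fun x =>
      2 * c x * inner ℝ (partialDeriv k v x) (E (partialDeriv j v x))
        + partialDeriv k c x * inner ℝ (v x) (E (partialDeriv j v x))
        - partialDeriv j c x * inner ℝ (v x) (E (partialDeriv k v x)) := by
  have hvj := hv.partialDeriv j
  have hvk := hv.partialDeriv k
  -- The integrand is `∂_k (c ⟨v, E ∂_j v⟩) - ∂_j (c ⟨v, E ∂_k v⟩)`. The second derivatives of `v`
  -- cancel by symmetry, and skewness of `E` makes the two gradient terms add up.
  have h1 := hasZeroIntegral_partialDeriv (contDiff_mul_inner E hc hv hvj)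
    (hasCompactSupport_mul_inner E hs) k
  have h2 := hasZeroIntegral_partialDeriv (contDiff_mul_inner E hc hv hvk)
    (hasCompactSupport_mul_inner E hs) j
  convert h1.sub h2 using 2 with x
  rw [partialDeriv_mul_inner k E hc.differentiableAt_of_smooth hv.differentiableAt_of_smooth
      hvj.differentiableAt_of_smooth,
    partialDeriv_mul_inner j E hc.differentiableAt_of_smooth hv.differentiableAt_of_smooth
      hvk.differentiableAt_of_smooth,
    partialDeriv_comm hv j k x]
  have : inner ℝ (partialDeriv j v x) (E (partialDeriv k v x))
      = -inner ℝ (partialDeriv k v x) (E (partialDeriv j v x)) := by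
    rw [real_inner_comm, hE]
  rw [this]
  ring

/-- The integrand is `∂_k (c ‖v‖²)`. -/
theorem hasZeroIntegral_scalar {c : E3 → ℝ} {v : E3 → V}
    (hc : ContDiff ℝ ∞ c) (hv : ContDiff ℝ ∞ v) (hs : HasCompactSupport v) (k : Fin 3) :
    HasZeroIntegral fun x =>
      2 * c x * inner ℝ (v x) (partialDeriv k v x) + partialDeriv k c x * ‖v x‖ ^ 2 := by
  have h1 := hasZeroIntegral_partialDeriv (contDiff_mul_inner (.id ℝ V) hc hv hv)
    (hasCompactSupport_mul_inner _ hs) k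
  convert h1 using 2 with x
  rw [partialDeriv_mul_inner k _ hc.differentiableAt_of_smooth hv.differentiableAt_of_smooth
    hv.differentiableAt_of_smooth]
  simp only [ContinuousLinearMap.id_apply, real_inner_self_eq_norm_sq]
  rw [real_inner_comm (v x) (partialDeriv k v x)]
  ring

end ZeroIntegral

/-! ### Quaternionic algebra and the cross-term identity. -/

section Clifford

variable {V : Type*} [NormedAddCommGroup V] [InnerProductSpace ℝ V]

/-- Three skew-adjoint operators satisfying the relations of the quaternion units
`-i, -j, -k`; the operators `i σ_m` are an example. -/
structure IsCliffordTriple (e : Fin 3 → V →L[ℝ] V) : Prop where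
  skew : ∀ m y z, inner ℝ (e m y) z = -inner ℝ y (e m z)
  sq : ∀ m y, e m (e m y) = -y
  mul_succ : ∀ m y, e m (e (m + 1) y) = -e (m + 2) y
  succ_mul : ∀ m y, e (m + 1) (e m y) = e (m + 2) y

/-- Clifford multiplication `b · e`. -/
def cliffordMul (e : Fin 3 → V →L[ℝ] V) (b : Fin 3 → ℝ) (y : V) : V := ∑ m, b m • e m y

/-- The derivative `b · ∇` in terms of the partial derivatives `D`. -/
def directional (b : Fin 3 → ℝ) (D : Fin 3 → V) : V := ∑ m, b m • D m

/-- The operator `e · (b × ∇)` in terms of the partial derivatives `D`. -/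
def tangential (e : Fin 3 → V →L[ℝ] V) (b : Fin 3 → ℝ) (D : Fin 3 → V) : V :=
  ∑ m, e m (b (m + 1) • D (m + 2) - b (m + 2) • D (m + 1))

/-- Half of the curl of a vector field with partial derivatives `d k j = ∂_k a_j`. -/
def halfCurl (d : Fin 3 → Fin 3 → ℝ) (m : Fin 3) : ℝ :=
  (d (m + 1) (m + 2) - d (m + 2) (m + 1)) / 2

variable {e : Fin 3 → V →L[ℝ] V}

theorem IsCliffordTriple.inner_self (he : IsCliffordTriple e) (m : Fin 3) (y : V) :
    inner ℝ y (e m y) = 0 := by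
  have h := he.skew m y y
  rw [real_inner_comm] at h
  linarith

theorem IsCliffordTriple.norm_apply (he : IsCliffordTriple e) (m : Fin 3) (y : V) :
    ‖e m y‖ = ‖y‖ := by
  have h : ‖e m y‖ ^ 2 = ‖y‖ ^ 2 := by
    rw [← real_inner_self_eq_norm_sq, he.skew, he.sq, inner_neg_right, neg_neg,
      real_inner_self_eq_norm_sq]
  exact (sq_eq_sq₀ (norm_nonneg _) (norm_nonneg _)).1 h

theorem IsCliffordTriple.norm_cliffordMul_le (he : IsCliffordTriple e) {b : Fin 3 → ℝ} {M : ℝ}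
    (hb : ∀ m, |b m| ≤ M) (y : V) : ‖cliffordMul e b y‖ ≤ 3 * M * ‖y‖ := by
  refine (norm_sum_le _ _).trans ?_
  have : ∀ m ∈ Finset.univ, ‖b m • e m y‖ ≤ M * ‖y‖ := fun m _ => by
    rw [norm_smul, he.norm_apply]
    exact mul_le_mul_of_nonneg_right (hb m) (norm_nonneg _)
  refine (Finset.sum_le_sum this).trans ?_
  simp [mul_assoc]

/-- Clifford multiplication of the Dirac operator by a vector. -/
theorem IsCliffordTriple.cliffordMul_dirac (he : IsCliffordTriple e) (b : Fin 3 → ℝ)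
    (D : Fin 3 → V) :
    cliffordMul e b (∑ m, e m (D m)) = -(directional b D + tangential e b D) := by
  have h01 := he.mul_succ 0
  have h12 := he.mul_succ 1
  have h20 := he.mul_succ 2
  have h10 := he.succ_mul 0
  have h21 := he.succ_mul 1
  have h02 := he.succ_mul 2
  simp only [show (0 + 1 : Fin 3) = 1 from rfl, show (0 + 2 : Fin 3) = 2 from rfl,
    show (1 + 1 : Fin 3) = 2 from rfl, show (1 + 2 : Fin 3) = 0 from rfl,
    show (2 + 1 : Fin 3) = 0 from rfl, show (2 + 2 : Fin 3) = 1 from rfl]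
    at h01 h12 h20 h10 h21 h02
  simp only [cliffordMul, directional, tangential, Fin.sum_univ_three, map_add, map_sub, map_smul,
    show (0 + 1 : Fin 3) = 1 from rfl, show (0 + 2 : Fin 3) = 2 from rfl,
    show (1 + 1 : Fin 3) = 2 from rfl, show (1 + 2 : Fin 3) = 0 from rfl,
    show (2 + 1 : Fin 3) = 0 from rfl, show (2 + 2 : Fin 3) = 1 from rfl,
    h01, h12, h20, h10, h21, h02, he.sq]
  module

/-- The pointwise algebraic identity behind the Carleman estimate. -/
theorem IsCliffordTriple.cross_term_identity (he : IsCliffordTriple e) (v : V) (D : Fin 3 → V)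
    (a : Fin 3 → ℝ) (d : Fin 3 → Fin 3 → ℝ) (f μ κ s : ℝ) (df : Fin 3 → ℝ)
    (hdiag : ∀ j, d j j = μ) (hskew : ∀ j k, j ≠ k → d j k = -d k j)
    (hf : ∑ m, a m * df m = -κ) :
    2 * inner ℝ (directional a D) (tangential e a D + f • v)
      - (κ * ‖v‖ ^ 2 - 3 * μ * inner ℝ v (tangential e a D + f • v)
        + inner ℝ v (cliffordMul e (halfCurl d) (tangential e a D + f • v))
        - 2 * inner ℝ v (cliffordMul e (halfCurl d) (directional a D)) - s * ‖v‖ ^ 2)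
    = (∑ k, ∑ m, ((2 * (a k * a (m + 1)) * inner ℝ (D k) (e m (D (m + 2)))
          + (a k * d k (m + 1) + d k k * a (m + 1)) * inner ℝ v (e m (D (m + 2)))
          - (a k * d (m + 2) (m + 1) + d (m + 2) k * a (m + 1)) * inner ℝ v (e m (D k)))
        - (2 * (a k * a (m + 2)) * inner ℝ (D k) (e m (D (m + 1)))
          + (a k * d k (m + 2) + d k k * a (m + 2)) * inner ℝ v (e m (D (m + 1)))
          - (a k * d (m + 1) (m + 2) + d (m + 1) k * a (m + 2)) * inner ℝ v (e m (D k)))))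
      + (∑ k, (2 * (f * a k) * inner ℝ v (D k) + (f * d k k + df k * a k) * ‖v‖ ^ 2)
      + (∑ k, 2 * ((halfCurl d (k + 1) * a (k + 2) - halfCurl d (k + 2) * a (k + 1)) / 2)
          * inner ℝ v (D k) + s * ‖v‖ ^ 2)) := by
  have h01 := he.mul_succ 0
  have h12 := he.mul_succ 1
  have h20 := he.mul_succ 2
  have h10 := he.succ_mul 0
  have h21 := he.succ_mul 1
  have h02 := he.succ_mul 2
  have hvv := real_inner_self_eq_norm_sq v
  -- Conformality reduces the Jacobian to `μ` and three off-diagonal entries, which are the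
  -- components of half the curl.
  have s10 : d 1 0 = -d 0 1 := hskew 1 0 (by decide)
  have s21 : d 2 1 = -d 1 2 := hskew 2 1 (by decide)
  have s02 : d 0 2 = -d 2 0 := hskew 0 2 (by decide)
  have c0 : halfCurl d 0 = d 1 2 := by
    change (d 1 2 - d 2 1) / 2 = _
    rw [s21]; ring
  have c1 : halfCurl d 1 = d 2 0 := by
    change (d 2 0 - d 0 2) / 2 = _
    rw [s02]; ring
  have c2 : halfCurl d 2 = d 0 1 := by
    change (d 0 1 - d 1 0) / 2 = _
    rw [s10]; ring
  simp only [show (0 + 1 : Fin 3) = 1 from rfl, show (0 + 2 : Fin 3) = 2 from rfl,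
    show (1 + 1 : Fin 3) = 2 from rfl, show (1 + 2 : Fin 3) = 0 from rfl,
    show (2 + 1 : Fin 3) = 0 from rfl, show (2 + 2 : Fin 3) = 1 from rfl]
    at h01 h12 h20 h10 h21 h02
  have hD : ∀ k, inner ℝ (D k) v = inner ℝ v (D k) := fun k => real_inner_comm _ _
  simp only [Fin.sum_univ_three] at hf
  simp only [cliffordMul, directional, tangential, Fin.sum_univ_three, map_add, map_sub, map_smul,
    show (0 + 1 : Fin 3) = 1 from rfl, show (0 + 2 : Fin 3) = 2 from rfl,
    show (1 + 1 : Fin 3) = 2 from rfl, show (1 + 2 : Fin 3) = 0 from rfl,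
    show (2 + 1 : Fin 3) = 0 from rfl, show (2 + 2 : Fin 3) = 1 from rfl,
    h01, h12, h20, h10, h21, h02, he.sq, hdiag, s10, s21, s02, c0, c1, c2, inner_add_left,
    inner_add_right, inner_sub_right, inner_neg_right, real_inner_smul_left,
    real_inner_smul_right, he.inner_self, hvv, hD]
  -- Once everything is expanded in the products `⟨D k, e m (D j)⟩`, `⟨v, e m (D j)⟩` and `⟨v, D
  -- j⟩`, the two sides differ only by the `a · ∇f` term.
  linear_combination (-‖v‖ ^ 2) * hf

end Clifford

/-! ### The Carleman estimate for the conjugated operator. -/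

section Carleman

variable {V : Type*} [NormedAddCommGroup V] [InnerProductSpace ℝ V]

/-- The vector field `(½ curl a) × a / 2`. -/
def curlCross (a : Fin 3 → E3 → ℝ) (k : Fin 3) (x : E3) : ℝ :=
  (halfCurl (fun i j => partialDeriv i (a j) x) (k + 1) * a (k + 2) x
    - halfCurl (fun i j => partialDeriv i (a j) x) (k + 2) * a (k + 1) x) / 2

theorem contDiff_halfCurl {a : Fin 3 → E3 → ℝ} (ha : ∀ j, ContDiff ℝ ∞ (a j)) (m : Fin 3) :
    ContDiff ℝ ∞ fun x => halfCurl (fun i j => partialDeriv i (a j) x) m :=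
  (((ha _).partialDeriv _).sub ((ha _).partialDeriv _)).div_const 2

theorem contDiff_curlCross {a : Fin 3 → E3 → ℝ} (ha : ∀ j, ContDiff ℝ ∞ (a j)) (k : Fin 3) :
    ContDiff ℝ ∞ (curlCross a k) :=
  (((contDiff_halfCurl ha _).mul (ha _)).sub ((contDiff_halfCurl ha _).mul (ha _))).div_const 2

/-- The vector field `a` is conformal on `Ω`: its Jacobian is the sum of a multiple of the
identity and a skew-symmetric matrix. -/
structure IsConformalField (Ω : Set E3) (a : Fin 3 → E3 → ℝ) : Prop where
  diag : ∀ x ∈ Ω, ∀ j k, partialDeriv j (a j) x = partialDeriv k (a k) x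
  skew : ∀ x ∈ Ω, ∀ j k, j ≠ k → partialDeriv j (a k) x = -partialDeriv k (a j) x

/-- The conjugated operator `a · ∇ + e · (a × ∇) + f`. -/
def conjugatedDirac (e : Fin 3 → V →L[ℝ] V) (a : Fin 3 → E3 → ℝ) (f : E3 → ℝ) (v : E3 → V)
    (x : E3) : V :=
  directional (fun j => a j x) (fun j => partialDeriv j v x)
    + (tangential e (fun j => a j x) (fun j => partialDeriv j v x) + f x • v x)

/-- The errors cost at most `6M‖v‖‖B‖ + 6M‖v‖‖X‖ + M‖v‖²`. Completing the square in `‖B‖` and in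
`‖X‖` costs `9M²‖v‖²` each, whence `18 * M ^ 2`. -/
theorem quadratic_lower_bound {X B v : V} {M G κ c₁ c₂ c₃ s : ℝ}
    (hG : 2 * inner ℝ X B - (κ * ‖v‖ ^ 2 - c₁ + c₂ - c₃ - s * ‖v‖ ^ 2) = G)
    (h₁ : |c₁| ≤ 3 * M * (‖v‖ * ‖B‖)) (h₂ : |c₂| ≤ 3 * M * (‖v‖ * ‖B‖))
    (h₃ : |c₃| ≤ 6 * M * (‖v‖ * ‖X‖)) (hs : |s| ≤ M) :
    G + (κ - M - 18 * M ^ 2) * ‖v‖ ^ 2 ≤ ‖X + B‖ ^ 2 := by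
  rw [norm_add_sq_real]
  have e₁ := (abs_le.1 h₁).2
  have e₂ := (abs_le.1 h₂).1
  have e₃ := (abs_le.1 h₃).2
  have e₄ : s * ‖v‖ ^ 2 ≤ M * ‖v‖ ^ 2 :=
    mul_le_mul_of_nonneg_right (abs_le.1 hs).2 (sq_nonneg _)
  nlinarith [sq_nonneg (‖B‖ - 3 * M * ‖v‖), sq_nonneg (‖X‖ - 3 * M * ‖v‖)]

/-- The pointwise bound holds up to a sum of divergences `G`, which integrates to zero. No bound on
`f` enters, only its derivative along `a`; this is what makes the constants uniform in `t`. -/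
theorem IsCliffordTriple.carleman_estimate {e : Fin 3 → V →L[ℝ] V} (he : IsCliffordTriple e)
    {Ω : Set E3} {a : Fin 3 → E3 → ℝ} (ha : ∀ j, ContDiff ℝ ∞ (a j)) (hconf : IsConformalField Ω a)
    {M : ℝ} (hM : ∀ x ∈ Ω, ∀ j k, |partialDeriv j (a k) x| ≤ M)
    (hM' : ∀ x ∈ Ω, |∑ k, partialDeriv k (curlCross a k) x| ≤ M)
    {f : E3 → ℝ} (hf : ContDiff ℝ ∞ f) {κ : ℝ}
    (hfκ : ∀ x ∈ Ω, ∑ m, a m x * partialDeriv m f x = -κ)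
    {v : E3 → V} (hv : IsTestFunction Ω v) :
    (κ - M - 18 * M ^ 2) * ∫ x, ‖v x‖ ^ 2 ≤ ∫ x, ‖conjugatedDirac e a f v x‖ ^ 2 := by
  obtain ⟨hv, hc, hsupp⟩ := hv
  -- The divergences come from three sources: the second-order part of `2⟨X, B⟩`, with coefficients
  -- `a_k a_{m+1}` and `a_k a_{m+2}`; the product of `X` with `f v`; and the scalar part of the
  -- Clifford product of half the curl with `e · (a × ∇)v`, which is a derivative along `curlCross
  -- a`.
  obtain ⟨G, hG, hN⟩ : ∃ G : E3 → ℝ, (∀ x, G x =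
      (∑ k, ∑ m, ((2 * (a k x * a (m + 1) x)
            * inner ℝ (partialDeriv k v x) (e m (partialDeriv (m + 2) v x))
          + partialDeriv k (fun y => a k y * a (m + 1) y) x
            * inner ℝ (v x) (e m (partialDeriv (m + 2) v x))
          - partialDeriv (m + 2) (fun y => a k y * a (m + 1) y) x
            * inner ℝ (v x) (e m (partialDeriv k v x)))
        - (2 * (a k x * a (m + 2) x)
            * inner ℝ (partialDeriv k v x) (e m (partialDeriv (m + 1) v x))
          + partialDeriv k (fun y => a k y * a (m + 2) y) x
            * inner ℝ (v x) (e m (partialDeriv (m + 1) v x))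
          - partialDeriv (m + 1) (fun y => a k y * a (m + 2) y) x
            * inner ℝ (v x) (e m (partialDeriv k v x)))))
      + ((∑ k, (2 * (f x * a k x) * inner ℝ (v x) (partialDeriv k v x)
          + partialDeriv k (fun y => f y * a k y) x * ‖v x‖ ^ 2))
      + (∑ k, (2 * curlCross a k x * inner ℝ (v x) (partialDeriv k v x)
          + partialDeriv k (curlCross a k) x * ‖v x‖ ^ 2)))) ∧ HasZeroIntegral G := by
    refine ⟨_, fun x => rfl, ?_⟩
    refine HasZeroIntegral.add (.sum fun k _ => .sum fun m _ => .sub ?_ ?_)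
      (.add (.sum fun k _ => ?_) (.sum fun k _ => ?_))
    · exact hasZeroIntegral_skew (e m) (he.skew m) ((ha k).mul (ha _)) hv hc _ _
    · exact hasZeroIntegral_skew (e m) (he.skew m) ((ha k).mul (ha _)) hv hc _ _
    · exact hasZeroIntegral_scalar (hf.mul (ha k)) hv hc k
    · exact hasZeroIntegral_scalar (contDiff_curlCross ha k) hv hc k
  have hQ : Continuous (conjugatedDirac e a f v) := by
    have h1 := fun j => (ha j).continuous
    have h2 := fun j => (hv.partialDeriv j).continuous
    have h3 := hf.continuous
    have h4 := hv.continuous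
    unfold conjugatedDirac directional tangential
    fun_prop
  have hQs : HasCompactSupport (conjugatedDirac e a f v) := hc.mono' fun x hx => by
    contrapose! hx
    obtain ⟨h0, h1⟩ := eq_zero_of_notMem_tsupport hx
    simp [conjugatedDirac, directional, tangential, h0, h1]
  have hi : ∀ w : E3 → V, Continuous w → HasCompactSupport w → Integrable fun x => ‖w x‖ ^ 2 :=
    fun w hw hwc => (hw.norm.pow 2).integrable_of_hasCompactSupport
      (hwc.mono fun x hx => by contrapose! hx; simp [Function.notMem_support.1 hx])
  have hvi := hi v hv.continuous hc
  have key : ∀ x, G x + (κ - M - 18 * M ^ 2) * ‖v x‖ ^ 2 ≤ ‖conjugatedDirac e a f v x‖ ^ 2 := by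
    intro x
    -- The bounds on `a` hold only on `Ω`; off the support of `v` both sides vanish.
    by_cases hx : x ∈ tsupport v
    swap
    · obtain ⟨h0, h1⟩ := eq_zero_of_notMem_tsupport hx
      simp [hG, h0, h1]
    replace hx := hsupp hx
    have hid := he.cross_term_identity (v x) (fun j => partialDeriv j v x) (fun j => a j x)
      (fun i j => partialDeriv i (a j) x) (f x) (partialDeriv 0 (a 0) x) κ
      (∑ k, partialDeriv k (curlCross a k) x) (fun j => partialDeriv j f x)
      (fun j => hconf.diag x hx j 0) (hconf.skew x hx) (hfκ x hx)
    have hGx : _ = G x := hid.trans <| by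
      have hp := fun j k l => partialDeriv_mul j
        ((ha k).differentiableAt_of_smooth (x := x)) (ha l).differentiableAt_of_smooth
      have hp' := fun j k => partialDeriv_mul j
        (hf.differentiableAt_of_smooth (x := x)) (ha k).differentiableAt_of_smooth
      simp only [hG, hp, hp', Finset.sum_add_distrib, Finset.sum_mul, curlCross]
    have hpM : ∀ m, |halfCurl (fun i j => partialDeriv i (a j) x) m| ≤ M := fun m => by
      have h1 := abs_le.1 (hM x hx (m + 1) (m + 2))
      have h2 := abs_le.1 (hM x hx (m + 2) (m + 1))
      rw [halfCurl, abs_le]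
      constructor <;> linarith
    refine quadratic_lower_bound hGx ?_ ?_ ?_ (hM' x hx)
    · rw [abs_mul, abs_mul, abs_of_nonneg (by norm_num : (0 : ℝ) ≤ 3)]
      have := abs_real_inner_le_norm (v x) (tangential e (fun j => a j x)
        (fun j => partialDeriv j v x) + f x • v x)
      have h0 := hM x hx 0 0
      have hM0 : 0 ≤ M := (abs_nonneg _).trans h0
      gcongr
    · refine (abs_real_inner_le_norm _ _).trans ?_
      have := he.norm_cliffordMul_le hpM (tangential e (fun j => a j x)
        (fun j => partialDeriv j v x) + f x • v x)
      nlinarith [mul_le_mul_of_nonneg_left this (norm_nonneg (v x))]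
    · rw [abs_mul, abs_of_nonneg (by norm_num : (0 : ℝ) ≤ 2)]
      have h1 := abs_real_inner_le_norm (v x) (cliffordMul e
        (halfCurl (fun i j => partialDeriv i (a j) x))
        (directional (fun j => a j x) (fun j => partialDeriv j v x)))
      have := he.norm_cliffordMul_le hpM
        (directional (fun j => a j x) (fun j => partialDeriv j v x))
      nlinarith [mul_le_mul_of_nonneg_left this (norm_nonneg (v x))]
  calc (κ - M - 18 * M ^ 2) * ∫ x, ‖v x‖ ^ 2
      = ∫ x, (G x + (κ - M - 18 * M ^ 2) * ‖v x‖ ^ 2) := by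
        rw [integral_add hN.1 (hvi.const_mul _), hN.2, zero_add, integral_const_mul]
    _ ≤ _ := integral_mono (hN.1.add (hvi.const_mul _)) (hi _ hQ hQs) key

end Carleman

/-! ### Geometry of limiting Carleman weights. -/

section Weight

/-- A function smooth on an open neighbourhood of a closed set agrees near that set with a
globally smooth function. -/
theorem exists_contDiff_eventuallyEq {F : Type*} [NormedAddCommGroup F] [NormedSpace ℝ F]
    {U K : Set E3} (hU : IsOpen U) (hK : IsClosed K) (hKU : K ⊆ U) {g : E3 → F}
    (hg : ContDiffOn ℝ ∞ g U) :
    ∃ G : E3 → F, ContDiff ℝ ∞ G ∧ ∀ x ∈ K, G =ᶠ[nhds x] g := by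
  obtain ⟨χ, h0, h1, -⟩ := exists_contMDiffMap_zero_one_nhds_of_isClosed (n := ⊤)
    (modelWithCornersSelf ℝ E3) hU.isClosed_compl hK
    (Set.disjoint_left.2 fun x hx hxK => hx (hKU hxK))
  have hχ : ContDiff ℝ ∞ χ := χ.contMDiff.contDiff
  refine ⟨fun x => χ x • g x, contDiff_iff_contDiffAt.2 fun x => ?_, fun x hx => ?_⟩
  · by_cases hx : x ∈ U
    · exact hχ.contDiffAt.smul (hg.contDiffAt (hU.mem_nhds hx))
    · have : (fun y => χ y • g y) =ᶠ[nhds x] fun _ => 0 := by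
        filter_upwards [nhds_le_nhdsSet (Set.mem_compl hx) h0] with y hy
        rw [hy, zero_smul]
      exact contDiffAt_const.congr_of_eventuallyEq this
  · filter_upwards [nhds_le_nhdsSet hx h1] with y hy
    rw [hy, one_smul]

/-- A symmetric bilinear form which is constant, with value `-H g g`, on the circle
`{ξ ⊥ g, ‖ξ‖ = ‖g‖}` is determined by `g` and `H g`. -/
theorem bilin_eq_of_circle {E : Type*} [NormedAddCommGroup E] [InnerProductSpace ℝ E]
    (H : E →L[ℝ] E →L[ℝ] ℝ) (hH : ∀ y z, H y z = H z y) {g : E} (hg : g ≠ 0)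
    (h : ∀ ξ, ‖ξ‖ = ‖g‖ → inner ℝ g ξ = 0 → H ξ ξ + H g g = 0) (y z : E) :
    ‖g‖ ^ 2 * H y z = -H g g * inner ℝ y z + (H g z * inner ℝ g y + inner ℝ g z * H g y) := by
  have hg0 : ‖g‖ ≠ 0 := norm_ne_zero_iff.2 hg
  -- Homogeneity: any nonzero vector orthogonal to `g` rescales onto the circle.
  have perp : ∀ η, inner ℝ g η = 0 → ‖g‖ ^ 2 * H η η = -H g g * ‖η‖ ^ 2 := by
    intro η hη
    rcases eq_or_ne η 0 with rfl | hne
    · simp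
    have hη0 : ‖η‖ ≠ 0 := norm_ne_zero_iff.2 hne
    have := h ((‖g‖ / ‖η‖) • η) (by rw [norm_smul]; simp [hη0])
      (by rw [inner_smul_right, hη, mul_zero])
    simp only [map_smul, smul_apply, smul_eq_mul] at this
    field_simp at this
    linarith
  -- Apply `perp` to the component of `y` orthogonal to `g`; polarization then gives the bilinear
  -- form.
  have diag : ∀ y, ‖g‖ ^ 2 * H y y
      = -H g g * ‖y‖ ^ 2 + 2 * (H g y * inner ℝ g y) := by
    intro y
    set t : ℝ := inner ℝ g y / ‖g‖ ^ 2 with ht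
    have htg : inner ℝ g y = t * ‖g‖ ^ 2 := by rw [ht]; field_simp
    have hη : inner ℝ g (y - t • g) = 0 := by
      rw [inner_sub_right, inner_smul_right, real_inner_self_eq_norm_sq, htg, sub_self]
    have hp := perp _ hη
    have hn : ‖y - t • g‖ ^ 2 = ‖y‖ ^ 2 - t ^ 2 * ‖g‖ ^ 2 := by
      rw [norm_sub_sq_real, inner_smul_right, real_inner_comm, htg, norm_smul, mul_pow,
        Real.norm_eq_abs, sq_abs]
      ring
    rw [hn] at hp
    simp only [map_sub, map_smul, sub_apply, smul_apply,
      smul_eq_mul, hH y g] at hp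
    rw [htg]
    linear_combination hp
  have h1 := diag (y + z)
  have h2 := diag y
  have h3 := diag z
  simp only [map_add, add_apply, inner_add_right, norm_add_sq_real,
    hH z y] at h1
  linear_combination (h1 - h2 - h3) / 2

theorem sum_coord_smul_basisVec (x : E3) : ∑ j, x j • basisVec j = x := by
  ext i
  fin_cases i <;> simp [basisVec, Fin.sum_univ_three]

theorem inner_basisVec (x : E3) (j : Fin 3) : inner ℝ x (basisVec j) = x j := by
  simp [basisVec, EuclideanSpace.inner_single_right]

theorem gradient_apply (φ : E3 → ℝ) (x : E3) (j : Fin 3) : ∇ φ x j = partialDeriv j φ x := by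
  rw [← inner_basisVec, partialDeriv, gradient, InnerProductSpace.toDual_symm_apply]

/-- Turns the bracket condition into a condition on the Hessian, on the circle `|ξ| = |∇φ|`, `ξ ⊥
∇φ` where both symbols vanish. -/
theorem poissonBracket_symbol {φ : E3 → ℝ} {x : E3} (hφ : ContDiffAt ℝ ∞ φ x) (ξ : E3) :
    poissonBracket (symbolRe φ) (symbolIm φ) x ξ
      = 4 * (fderiv ℝ (fderiv ℝ φ) x ξ ξ + fderiv ℝ (fderiv ℝ φ) x (∇ φ x) (∇ φ x)) := by
  have hd : DifferentiableAt ℝ (fderiv ℝ φ) x :=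
    (hφ.fderiv_right (m := ∞) le_rfl).differentiableAt (by simp)
  set H := fderiv ℝ (fderiv ℝ φ) x with hH
  have hgrad : DifferentiableAt ℝ (fun y => ∇ φ y) x := by
    have : (fun y => ∇ φ y) = fun y => ∑ j, fderiv ℝ φ y (basisVec j) • basisVec j := by
      funext y
      rw [← sum_coord_smul_basisVec (∇ φ y)]
      simp only [gradient_apply, partialDeriv]
    rw [this]
    fun_prop
  have hgd : ∀ w z, inner ℝ z (fderiv ℝ (fun y => ∇ φ y) x w) = H w z := by
    intro w z
    have h : (fun y => inner ℝ (∇ φ y) z) = fun y => fderiv ℝ φ y z := by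
      funext y
      rw [gradient, InnerProductSpace.toDual_symm_apply]
    have h' := congrArg (fun F => fderiv ℝ F x w) h
    rw [fderiv_inner_apply ℝ hgrad (differentiableAt_const z),
      fderiv_clm_apply hd (differentiableAt_const z)] at h'
    rw [real_inner_comm]
    simpa using h'
  have h1 : ∀ j, partialDeriv j (fun η => symbolRe φ x η) ξ = 2 * ξ j := by
    intro j
    simp only [partialDeriv, symbolRe, fderiv_sub_const]
    rw [fderiv_norm_sq_apply]
    simp [inner_basisVec]
  have h2 : ∀ j, partialDeriv j (fun η => symbolIm φ x η) ξ = 2 * ∇ φ x j := by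
    intro j
    simp only [partialDeriv, symbolIm]
    have : HasFDerivAt (fun η => 2 * inner ℝ (∇ φ x) η) ((2 : ℝ) • innerSL ℝ (∇ φ x)) ξ :=
      (innerSL ℝ (∇ φ x)).hasFDerivAt.const_mul 2
    rw [this.fderiv]
    simp [gradient_apply, partialDeriv]
  have h3 : ∀ j, partialDeriv j (fun y => symbolIm φ y ξ) x = 2 * H (basisVec j) ξ := by
    intro j
    simp only [partialDeriv, symbolIm]
    have h := (hgrad.inner ℝ (differentiableAt_const ξ))
    rw [fderiv_const_mul h]
    simp only [smul_apply, smul_eq_mul]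
    rw [fderiv_inner_apply ℝ hgrad (differentiableAt_const ξ)]
    simp only [fderiv_fun_const, Pi.zero_apply, zero_apply, inner_zero_right,
      zero_add]
    rw [real_inner_comm, hgd]
  have h4 : ∀ j, partialDeriv j (fun y => symbolRe φ y ξ) x = -(2 * H (basisVec j) (∇ φ x)) := by
    intro j
    simp only [partialDeriv, symbolRe]
    have h := hgrad.hasFDerivAt.norm_sq
    rw [(h.const_sub (‖ξ‖ ^ 2)).fderiv]
    simp [hgd]
  have hsum : ∀ y z : E3, H y z = ∑ j, y j * H (basisVec j) z := by
    intro y z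
    conv_lhs => rw [← sum_coord_smul_basisVec y]
    simp
  simp only [poissonBracket, h1, h2, h3, h4]
  rw [hsum ξ ξ, hsum (∇ φ x) (∇ φ x), ← Finset.sum_add_distrib, Finset.mul_sum]
  exact Finset.sum_congr rfl fun j _ => by ring

/-- The square of the length of the gradient. -/
def gradSq (φ : E3 → ℝ) (x : E3) : ℝ := ∑ m, partialDeriv m φ x ^ 2

theorem norm_gradient_sq (φ : E3 → ℝ) (x : E3) : ‖∇ φ x‖ ^ 2 = gradSq φ x := by
  simp [EuclideanSpace.norm_sq_eq, gradient_apply, gradSq]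

theorem contDiffOn_partialDeriv {F : Type*} [NormedAddCommGroup F] [NormedSpace ℝ F]
    {U : Set E3} (hU : IsOpen U) {φ : E3 → F}
    (hφ : ContDiffOn ℝ ∞ φ U) (j : Fin 3) : ContDiffOn ℝ ∞ (partialDeriv j φ) U :=
  (hφ.fderiv_of_isOpen hU (m := ∞) le_rfl).clm_apply contDiffOn_const

theorem contDiffOn_gradSq {U : Set E3} (hU : IsOpen U) {φ : E3 → ℝ}
    (hφ : ContDiffOn ℝ ∞ φ U) : ContDiffOn ℝ ∞ (gradSq φ) U :=
  ContDiffOn.sum fun m _ => (contDiffOn_partialDeriv hU hφ m).pow 2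

namespace IsLimitingCarlemanWeight

variable {U : Set E3} {φ : E3 → ℝ}

theorem gradSq_ne_zero (hφ : IsLimitingCarlemanWeight U φ) {x : E3} (hx : x ∈ U) :
    gradSq φ x ≠ 0 := by
  rw [← norm_gradient_sq]
  exact pow_ne_zero 2 (norm_ne_zero_iff.2 (hφ.gradient_ne_zero x hx))

/-- The Hessian of a limiting Carleman weight. -/
theorem exists_hessian_eq (hφ : IsLimitingCarlemanWeight U φ) (hU : IsOpen U) {x : E3}
    (hx : x ∈ U) :
    ∃ l : ℝ, ∀ j k, gradSq φ x * partialDeriv j (partialDeriv k φ) x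
      = (if j = k then l else 0)
        + ((∑ m, partialDeriv m φ x * partialDeriv k (partialDeriv m φ) x) * partialDeriv j φ x
          + partialDeriv k φ x *
            ∑ m, partialDeriv m φ x * partialDeriv j (partialDeriv m φ) x) := by
  have hφx : ContDiffAt ℝ ∞ φ x := hφ.smooth.contDiffAt (hU.mem_nhds hx)
  have hd : DifferentiableAt ℝ (fderiv ℝ φ) x :=
    (hφx.fderiv_right (m := ∞) le_rfl).differentiableAt (by simp)
  have hsymm := hφx.isSymmSndFDerivAt
    (by simpa using WithTop.coe_le_coe.2 (le_top : (2 : ℕ∞) ≤ ⊤))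
  have hH : ∀ j k, partialDeriv j (partialDeriv k φ) x
      = fderiv ℝ (fderiv ℝ φ) x (basisVec j) (basisVec k) := by
    intro j k
    have : partialDeriv k φ = fun y => fderiv ℝ φ y (basisVec k) := rfl
    rw [this]
    simp only [partialDeriv]
    rw [fderiv_clm_apply hd (differentiableAt_const _)]
    simp
  have hHg : ∀ k, fderiv ℝ (fderiv ℝ φ) x (∇ φ x) (basisVec k)
      = ∑ m, partialDeriv m φ x * partialDeriv k (partialDeriv m φ) x := by
    intro k
    conv_lhs => rw [← sum_coord_smul_basisVec (∇ φ x)]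
    simp only [map_sum, map_smul, sum_apply, smul_apply,
      smul_eq_mul, gradient_apply]
    exact Finset.sum_congr rfl fun m _ => by rw [hH, hsymm.eq]
  refine ⟨-fderiv ℝ (fderiv ℝ φ) x (∇ φ x) (∇ φ x), fun j k => ?_⟩
  have h := bilin_eq_of_circle (fderiv ℝ (fderiv ℝ φ) x) (fun y z => hsymm.eq y z)
    (hφ.gradient_ne_zero x hx) (fun ξ h1 h2 => by
      have := hφ.bracket_eq_zero x hx ξ (by rw [symbolRe, h1, sub_self])
        (by rw [symbolIm, h2, mul_zero])
      rw [poissonBracket_symbol hφx] at this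
      linarith) (basisVec j) (basisVec k)
  have hjk : inner ℝ (basisVec j) (basisVec k) = if j = k then (1 : ℝ) else 0 := by
    rw [inner_basisVec]
    simp [basisVec, eq_comm]
  rw [norm_gradient_sq, hjk, inner_basisVec, inner_basisVec, gradient_apply, gradient_apply,
    hHg, hHg, ← hH] at h
  rw [h]
  split_ifs <;> ring

/-- The rescaled gradient `∇φ / |∇φ|²` of a limiting Carleman weight is a conformal field. -/
theorem isConformalField (hφ : IsLimitingCarlemanWeight U φ) (hU : IsOpen U) {K : Set E3}
    (hKU : K ⊆ U) {a : Fin 3 → E3 → ℝ} (ha : ∀ j, ContDiff ℝ ∞ (a j))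
    (haφ : ∀ x ∈ K, ∀ j, a j =ᶠ[nhds x] fun y => (gradSq φ y)⁻¹ * partialDeriv j φ y) :
    IsConformalField K a := by
  -- Differentiate `|∇φ|² a_j = ∂_jφ`, which avoids differentiating a quotient. With `p` the Hessian
  -- applied to `∇φ`, inserting the Hessian formula turns the right side into `l δ_jk + p_j ∂_kφ -
  -- p_k ∂_jφ`, a scalar plus a skew matrix.
  have key : ∀ x ∈ K, ∀ j k, gradSq φ x ^ 2 * partialDeriv k (a j) x
      = gradSq φ x * partialDeriv k (partialDeriv j φ) x
        - 2 * partialDeriv j φ x *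
          ∑ m, partialDeriv m φ x * partialDeriv k (partialDeriv m φ) x := by
    intro x hx j k
    have hS := (contDiffOn_gradSq hU hφ.smooth).contDiffAt (hU.mem_nhds (hKU hx))
    have hS' : DifferentiableAt ℝ (gradSq φ) x := hS.differentiableAt (by simp)
    have hP : ∀ m, DifferentiableAt ℝ (partialDeriv m φ) x := fun m =>
      ((contDiffOn_partialDeriv hU hφ.smooth m).contDiffAt
        (hU.mem_nhds (hKU hx))).differentiableAt (by simp)
    have heq : (fun y => gradSq φ y * a j y) =ᶠ[nhds x] partialDeriv j φ := by
      filter_upwards [haφ x hx j, hU.mem_nhds (hKU hx)] with y hy hyU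
      rw [hy, mul_inv_cancel_left₀ (hφ.gradSq_ne_zero hyU)]
    have h1 := heq.partialDeriv_eq k
    rw [partialDeriv_mul k hS' (ha j).differentiableAt_of_smooth] at h1
    have h2 : partialDeriv k (gradSq φ) x
        = 2 * ∑ m, partialDeriv m φ x * partialDeriv k (partialDeriv m φ) x := by
      have : gradSq φ = fun y => ∑ m, partialDeriv m φ y ^ 2 := rfl
      rw [this]
      have hs : HasFDerivAt (fun y => ∑ m, partialDeriv m φ y ^ 2)
          (∑ m, (2 * partialDeriv m φ x) • fderiv ℝ (partialDeriv m φ) x) x :=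
        HasFDerivAt.fun_sum fun m _ => by simpa using (hP m).hasFDerivAt.pow 2
      rw [partialDeriv, hs.fderiv, Finset.mul_sum]
      simp [partialDeriv, mul_assoc]
    have h3 : gradSq φ x * a j x = partialDeriv j φ x := heq.eq_of_nhds
    rw [h2] at h1
    rw [← h1, ← h3]
    ring
  constructor
  · intro x hx
    obtain ⟨l, hl⟩ := hφ.exists_hessian_eq hU (hKU hx)
    have : ∀ j, partialDeriv j (a j) x = (gradSq φ x ^ 2)⁻¹ * l := fun j => by
      have h1 := key x hx j j
      have h2 := hl j j
      rw [if_pos rfl] at h2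
      rw [eq_inv_mul_iff_mul_eq₀ (pow_ne_zero 2 (hφ.gradSq_ne_zero (hKU hx))), h1, h2]
      ring
    intro j k
    rw [this, this]
  · intro x hx j k hjk
    obtain ⟨l, hl⟩ := hφ.exists_hessian_eq hU (hKU hx)
    have h1 := key x hx j k
    have h2 := key x hx k j
    have h3 := hl j k
    have h4 := hl k j
    rw [if_neg hjk] at h3
    rw [if_neg hjk.symm] at h4
    refine mul_left_cancel₀ (pow_ne_zero 2 (hφ.gradSq_ne_zero (hKU hx))) ?_
    linear_combination h1 + h2 + h3 + h4

end IsLimitingCarlemanWeight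

/-- Globally smooth data adapted to a limiting Carleman weight near `K`. -/
theorem IsLimitingCarlemanWeightNear.exists_field {K : Set E3} (hK : IsClosed K) {φ : E3 → ℝ}
    (hφ : IsLimitingCarlemanWeightNear K φ) :
    ∃ (a : Fin 3 → E3 → ℝ) (φ' : E3 → ℝ), (∀ j, ContDiff ℝ ∞ (a j)) ∧ ContDiff ℝ ∞ φ' ∧
      Set.EqOn φ' φ K ∧ IsConformalField K a ∧
      (∀ x ∈ K, ∑ m, a m x * partialDeriv m φ' x = 1) ∧
      ∀ x ∈ K, ∀ j k, a j x * partialDeriv k φ' x = a k x * partialDeriv j φ' x := by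
  obtain ⟨U, hU, hKU, hφ⟩ := hφ
  obtain ⟨φ', hφ', hφφ'⟩ := exists_contDiff_eventuallyEq hU hK hKU hφ.smooth
  -- The extensions must agree with the original data near each point of `K`, not just on `K`, so
  -- that derivatives agree there too.
  have hex : ∀ j, ∃ G : E3 → ℝ, ContDiff ℝ ∞ G ∧
      ∀ x ∈ K, G =ᶠ[nhds x] fun y => (gradSq φ y)⁻¹ * partialDeriv j φ y := fun j =>
    exists_contDiff_eventuallyEq hU hK hKU
      (((contDiffOn_gradSq hU hφ.smooth).inv fun x hx => hφ.gradSq_ne_zero hx).mul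
        (contDiffOn_partialDeriv hU hφ.smooth j))
  choose a ha haφ using hex
  have hax : ∀ x ∈ K, ∀ j, a j x = (gradSq φ x)⁻¹ * partialDeriv j φ x := fun x hx j =>
    (haφ j x hx).eq_of_nhds
  have hdx : ∀ x ∈ K, ∀ j, partialDeriv j φ' x = partialDeriv j φ x := fun x hx j =>
    (hφφ' x hx).partialDeriv_eq j
  refine ⟨a, φ', ha, hφ', fun x hx => (hφφ' x hx).eq_of_nhds,
    hφ.isConformalField hU hKU ha fun x hx j => haφ j x hx, fun x hx => ?_, fun x hx j k => ?_⟩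
  · have h0 := hφ.gradSq_ne_zero (hKU hx)
    simp only [hax x hx, hdx x hx, mul_assoc, ← Finset.mul_sum, ← sq]
    exact inv_mul_cancel₀ h0
  · rw [hax x hx, hax x hx, hdx x hx, hdx x hx]
    ring

end Weight

/-! ### The Pauli matrices as a Clifford triple, and the potential. -/

section Pauli

/-- The operator `i σ_j` on spinors. -/
def pauliUnit (j : Fin 3) : Spinor →L[ℝ] Spinor :=
  LinearMap.toContinuousLinearMap
    ((Complex.I • Matrix.toEuclideanLin (pauli j)).restrictScalars ℝ)

theorem pauliUnit_apply (j : Fin 3) (y : Spinor) :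
    pauliUnit j y = Complex.I • Matrix.toEuclideanLin (pauli j) y := rfl

theorem pauliUnit_zero_coord (y : Spinor) :
    pauliUnit 0 y 0 = Complex.I * y 1 ∧ pauliUnit 0 y 1 = Complex.I * y 0 := by
  simp [pauliUnit_apply, pauli, Matrix.toLpLin_apply, dotProduct]

theorem pauliUnit_one_coord (y : Spinor) :
    pauliUnit 1 y 0 = y 1 ∧ pauliUnit 1 y 1 = -y 0 := by
  simp [pauliUnit_apply, pauli, Matrix.toLpLin_apply, dotProduct, ← mul_assoc]

theorem pauliUnit_two_coord (y : Spinor) :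
    pauliUnit 2 y 0 = Complex.I * y 0 ∧ pauliUnit 2 y 1 = -(Complex.I * y 1) := by
  simp [pauliUnit_apply, pauli, Matrix.toLpLin_apply, dotProduct]

theorem isCliffordTriple_pauliUnit : IsCliffordTriple pauliUnit := by
  have h0 := pauliUnit_zero_coord
  have h1 := pauliUnit_one_coord
  have h2 := pauliUnit_two_coord
  have hI : ∀ z : ℂ, Complex.I * (Complex.I * z) = -z := fun z => by
    rw [← mul_assoc, Complex.I_mul_I, neg_one_mul]
  constructor
  · intro m y z
    fin_cases m <;>
      simp [PiLp.inner_apply, Fin.sum_univ_two, h0, h1, h2, Complex.inner] <;> ring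
  · intro m y
    ext i
    fin_cases m <;> fin_cases i <;> simp [h0, h1, h2, hI]
  · intro m y
    ext i
    fin_cases m <;> fin_cases i <;> simp [h0, h1, h2, hI]
  · intro m y
    ext i
    fin_cases m <;> fin_cases i <;> simp [h0, h1, h2, hI]

/-- The lower order part `σ · A + q I₂` of the operator. -/
def potentialTerm (A : E3 → E3) (q : E3 → ℂ) (u : E3 → Spinor) (x : E3) : Spinor :=
  (∑ j : Fin 3, ((A x j : ℝ) : ℂ) • Matrix.toEuclideanLin (pauli j) (u x)) + q x • u x

theorem pauliDirac_eq (A : E3 → E3) (q : E3 → ℂ) (u : E3 → Spinor) (du : Fin 3 → E3 → Spinor)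
    (x : E3) :
    pauliDirac A q u du x = potentialTerm A q u x - ∑ j, pauliUnit j (du j x) := by
  simp only [pauliDirac, potentialTerm, map_add, map_smul, pauliUnit_apply,
    Finset.sum_add_distrib, neg_smul, map_neg, Finset.sum_neg_distrib]
  abel

theorem norm_potentialTerm_le {A : E3 → E3} {q : E3 → ℂ} {x : E3} {M : ℝ} (hA : ‖A x‖ ≤ M)
    (hq : ‖q x‖ ≤ M) (u : E3 → Spinor) : ‖potentialTerm A q u x‖ ≤ 4 * M * ‖u x‖ := by
  have hj : ∀ j ∈ Finset.univ,
      ‖((A x j : ℝ) : ℂ) • Matrix.toEuclideanLin (pauli j) (u x)‖ ≤ M * ‖u x‖ := by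
    intro j _
    have h1 : ‖Matrix.toEuclideanLin (pauli j) (u x)‖ = ‖u x‖ := by
      rw [← isCliffordTriple_pauliUnit.norm_apply j (u x), pauliUnit_apply, norm_smul,
        Complex.norm_I, one_mul]
    rw [norm_smul, h1, Complex.norm_real]
    exact mul_le_mul_of_nonneg_right ((PiLp.norm_apply_le (A x) j).trans hA) (norm_nonneg _)
  have hs := (norm_sum_le _ _).trans (Finset.sum_le_sum hj)
  have hq' : ‖q x • u x‖ ≤ M * ‖u x‖ := by
    rw [norm_smul]
    exact mul_le_mul_of_nonneg_right hq (norm_nonneg _)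
  refine (norm_add_le _ _).trans ((add_le_add hs hq').trans ?_)
  simp
  linarith

end Pauli

/-! ### The free Carleman estimate on test functions. -/

section TestFunctions

variable {V : Type*} [NormedAddCommGroup V] [InnerProductSpace ℝ V]

/-- The derivative of the exponent is `(t + κφ)∇φ`. Its component along `a` is `t + κφ` by `h1`,
cancelled by the zeroth-order term, while `h2` says `a × ∇φ = 0`, so the tangential part does not
see the weight. -/
theorem conjugatedDirac_exp {e : Fin 3 → V →L[ℝ] V} (he : IsCliffordTriple e)
    {a : Fin 3 → E3 → ℝ} {φ : E3 → ℝ} (hφ : ContDiff ℝ ∞ φ) {u : E3 → V} (hu : ContDiff ℝ ∞ u)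
    {x : E3} (h1 : ∑ m, a m x * partialDeriv m φ x = 1)
    (h2 : ∀ j k, a j x * partialDeriv k φ x = a k x * partialDeriv j φ x) (t κ : ℝ) :
    conjugatedDirac e a (fun y => -(t + κ * φ y))
        (fun y => Real.exp (t * φ y + κ * (φ y ^ 2 / 2)) • u y) x
      = -cliffordMul e (fun j => a j x) (Real.exp (t * φ x + κ * (φ x ^ 2 / 2)) •
          ∑ m, e m (partialDeriv m u x)) := by
  have hφd : DifferentiableAt ℝ φ x := hφ.differentiableAt_of_smooth
  have hd : ∀ j, partialDeriv j (fun y => Real.exp (t * φ y + κ * (φ y ^ 2 / 2)) • u y) x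
      = Real.exp (t * φ x + κ * (φ x ^ 2 / 2)) • partialDeriv j u x
        + ((t + κ * φ x) * partialDeriv j φ x) •
          (Real.exp (t * φ x + κ * (φ x ^ 2 / 2)) • u x) := by
    intro j
    have hψ : HasFDerivAt (fun y => t * φ y + κ * (φ y ^ 2 / 2))
        ((t + κ * φ x) • fderiv ℝ φ x) x := by
      have hp : HasDerivAt (fun s : ℝ => t * s + κ * (s ^ 2 / 2)) (t + κ * φ x) (φ x) :=
        (((hasDerivAt_id (φ x)).const_mul t).add
          ((((hasDerivAt_id (φ x)).pow 2).div_const 2).const_mul κ)).congr_deriv (by simp)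
      exact hp.comp_hasFDerivAt x hφd.hasFDerivAt
    have hexp := hψ.exp
    rw [partialDeriv_smul j hexp.differentiableAt hu.differentiableAt_of_smooth]
    congr 1
    rw [partialDeriv, hexp.fderiv]
    simp only [smul_apply, smul_eq_mul, partialDeriv, smul_smul]
    ring_nf
  rw [Finset.smul_sum]
  simp only [← map_smul]
  rw [he.cliffordMul_dirac, neg_neg, conjugatedDirac]
  simp only [hd]
  generalize Real.exp (t * φ x + κ * (φ x ^ 2 / 2)) = E
  have e1 : directional (fun j => a j x) (fun j => E • partialDeriv j u x
        + ((t + κ * φ x) * partialDeriv j φ x) • E • u x)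
      = directional (fun j => a j x) (fun j => E • partialDeriv j u x)
        + (t + κ * φ x) • E • u x := by
    simp only [directional, smul_add, Finset.sum_add_distrib]
    congr 1
    simp only [smul_smul]
    rw [← Finset.sum_smul]
    congr 1
    calc _ = ((t + κ * φ x) * E) * ∑ m, a m x * partialDeriv m φ x := by
          rw [Finset.mul_sum]
          exact Finset.sum_congr rfl fun m _ => by ring
      _ = _ := by rw [h1, mul_one]
  have e2 : tangential e (fun j => a j x) (fun j => E • partialDeriv j u x
        + ((t + κ * φ x) * partialDeriv j φ x) • E • u x)
      = tangential e (fun j => a j x) (fun j => E • partialDeriv j u x) := by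
    simp only [tangential]
    refine Finset.sum_congr rfl fun m _ => congrArg (e m) ?_
    have := h2 (m + 1) (m + 2)
    simp only [smul_add, smul_smul]
    rw [show a (m + 1) x * ((t + κ * φ x) * partialDeriv (m + 2) φ x * E)
      = a (m + 2) x * ((t + κ * φ x) * partialDeriv (m + 1) φ x * E) by
        linear_combination (t + κ * φ x) * E * this]
    abel
  rw [e1, e2]
  module

theorem IsTestFunction.exp_smul {Ω : Set E3} {u : E3 → V} (hu : IsTestFunction Ω u) {ψ : E3 → ℝ}
    (hψ : ContDiff ℝ ∞ ψ) : IsTestFunction Ω fun x => Real.exp (ψ x) • u x where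
  smooth := hψ.exp.smul hu.smooth
  compactSupport := hu.compactSupport.smul_left
  tsupport_subset := (tsupport_smul_subset_right _ _).trans hu.tsupport_subset

/-- Carleman estimate for the free Dirac operator on test functions. -/
theorem IsCliffordTriple.exists_carleman_testFunction {e : Fin 3 → V →L[ℝ] V}
    (he : IsCliffordTriple e) {Ω : Set E3} (hΩo : IsOpen Ω) (hΩ : Bornology.IsBounded Ω)
    {φ : E3 → ℝ} (hφ : IsLimitingCarlemanWeightNear (closure Ω) φ) :
    ∃ N L : ℝ, 0 < L ∧ ∀ t κ : ℝ, ∀ u : E3 → V, IsTestFunction Ω u →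
      (κ - N) * ∫ x in Ω, ‖Real.exp (t * φ x + κ * (φ x ^ 2 / 2)) • u x‖ ^ 2
        ≤ L * ∫ x in Ω, ‖Real.exp (t * φ x + κ * (φ x ^ 2 / 2)) •
            ∑ m, e m (partialDeriv m u x)‖ ^ 2 := by
  obtain ⟨a, φ', ha, hφ', hφφ', hconf, h1, h2⟩ := hφ.exists_field isClosed_closure
  have hb : Continuous fun x => (∑ j, ∑ k, |partialDeriv j (a k) x|)
      + |∑ k, partialDeriv k (curlCross a k) x| + ∑ j, |a j x| := by
    have c1 := fun j k => ((ha k).partialDeriv j).continuous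
    have c2 := fun k => ((contDiff_curlCross ha k).partialDeriv k).continuous
    have c3 := fun k => (ha k).continuous
    fun_prop
  obtain ⟨M₀, hM₀⟩ := hΩ.isCompact_closure.exists_bound_of_continuousOn hb.continuousOn
  -- The maximum with `1` keeps `L = (3M)²` positive.
  set M := max M₀ 1 with hMdef
  have hM1 : 1 ≤ M := le_max_right _ _
  have hbd : ∀ x ∈ closure Ω, (∑ j, ∑ k, |partialDeriv j (a k) x|)
      + |∑ k, partialDeriv k (curlCross a k) x| + ∑ j, |a j x| ≤ M := fun x hx =>
    (le_abs_self _).trans ((hM₀ x hx).trans (le_max_left _ _))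
  have n1 : ∀ x, 0 ≤ ∑ j, ∑ k, |partialDeriv j (a k) x| := fun x =>
    Finset.sum_nonneg fun j _ => Finset.sum_nonneg fun k _ => abs_nonneg _
  have n2 : ∀ x, 0 ≤ |∑ k, partialDeriv k (curlCross a k) x| := fun x => abs_nonneg _
  have n3 : ∀ x, 0 ≤ ∑ j, |a j x| := fun x => Finset.sum_nonneg fun j _ => abs_nonneg _
  have hMd : ∀ x ∈ Ω, ∀ j k, |partialDeriv j (a k) x| ≤ M := fun x hx j k => by
    have s1 := Finset.single_le_sum (f := fun k => |partialDeriv j (a k) x|)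
      (fun k _ => abs_nonneg _) (Finset.mem_univ k)
    have s2 := Finset.single_le_sum (f := fun j => ∑ k, |partialDeriv j (a k) x|)
      (fun j _ => Finset.sum_nonneg fun k _ => abs_nonneg _) (Finset.mem_univ j)
    linarith [hbd x (subset_closure hx), n2 x, n3 x]
  have hMc : ∀ x ∈ Ω, |∑ k, partialDeriv k (curlCross a k) x| ≤ M := fun x hx => by
    linarith [hbd x (subset_closure hx), n1 x, n3 x]
  have hMa : ∀ x ∈ Ω, ∀ j, |a j x| ≤ M := fun x hx j => by
    have s1 := Finset.single_le_sum (f := fun j => |a j x|)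
      (fun k _ => abs_nonneg _) (Finset.mem_univ j)
    linarith [hbd x (subset_closure hx), n1 x, n2 x]
  have hconfΩ : IsConformalField Ω a :=
    ⟨fun x hx => hconf.diag x (subset_closure hx), fun x hx => hconf.skew x (subset_closure hx)⟩
  -- The first constant is the loss in `carleman_estimate`; the second bounds Clifford
  -- multiplication by `a`. Both depend only on `a` over the closure of `Ω`.
  refine ⟨M + 18 * M ^ 2, (3 * M) ^ 2, by positivity, fun t κ u hu => ?_⟩
  have hψ : ContDiff ℝ ∞ fun x => t * φ' x + κ * (φ' x ^ 2 / 2) := by fun_prop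
  have hf : ContDiff ℝ ∞ fun x => -(t + κ * φ' x) := by fun_prop
  have hv := hu.exp_smul hψ
  have hfκ : ∀ x ∈ Ω, ∑ m, a m x * partialDeriv m (fun x => -(t + κ * φ' x)) x = -κ := by
    intro x hx
    have hd : HasFDerivAt (fun x => -(t + κ * φ' x)) (-(κ • fderiv ℝ φ' x)) x :=
      ((hφ'.differentiableAt_of_smooth.hasFDerivAt.const_mul κ).const_add t).neg
    have : ∀ m, partialDeriv m (fun x => -(t + κ * φ' x)) x = -κ * partialDeriv m φ' x := by
      intro m
      rw [partialDeriv, hd.fderiv]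
      simp [partialDeriv]
    calc _ = -κ * ∑ m, a m x * partialDeriv m φ' x := by
          rw [Finset.mul_sum]
          exact Finset.sum_congr rfl fun m _ => by rw [this]; ring
      _ = _ := by rw [h1 x (subset_closure hx), mul_one]
  have main := he.carleman_estimate ha hconfΩ hMd hMc hf hfκ hv
  have hzero : ∀ x, x ∉ Ω → u x = 0 ∧ ∀ j, partialDeriv j u x = 0 := fun x hx =>
    eq_zero_of_notMem_tsupport fun h => hx (hu.tsupport_subset h)
  have toΩ : ∀ w : E3 → V, (∀ x, x ∉ Ω → w x = 0) →
      ∫ x, ‖Real.exp (t * φ' x + κ * (φ' x ^ 2 / 2)) • w x‖ ^ 2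
        = ∫ x in Ω, ‖Real.exp (t * φ x + κ * (φ x ^ 2 / 2)) • w x‖ ^ 2 := by
    intro w hw
    rw [← setIntegral_eq_integral_of_forall_compl_eq_zero (s := Ω)
      fun x hx => by rw [hw x hx]; simp]
    refine setIntegral_congr_fun hΩo.measurableSet fun x hx => ?_
    simp only [hφφ' (subset_closure hx)]
  rw [← toΩ u fun x hx => (hzero x hx).1, ← toΩ _ fun x hx => by simp [(hzero x hx).2],
    ← integral_const_mul ((3 * M) ^ 2), ← sub_sub]
  refine main.trans (integral_mono_of_nonneg
    (.of_forall fun x => sq_nonneg ‖_‖) ?_ (.of_forall fun x => ?_))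
  · have c1 := hψ.continuous
    have c2 := fun m => (hu.smooth.partialDeriv m).continuous
    refine Continuous.integrable_of_hasCompactSupport (by fun_prop)
      (hu.compactSupport.mono' fun x hx => ?_)
    contrapose! hx
    simp [(eq_zero_of_notMem_tsupport hx).2]
  · simp only
    by_cases hx : x ∈ Ω
    · rw [conjugatedDirac_exp he hφ' hu.smooth (h1 x (subset_closure hx))
        (h2 x (subset_closure hx)), norm_neg, ← mul_pow]
      exact pow_le_pow_left₀ (norm_nonneg _) (he.norm_cliffordMul_le (hMa x hx) _) 2
    · have hx' : x ∉ tsupport fun x => Real.exp (t * φ' x + κ * (φ' x ^ 2 / 2)) • u x :=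
        fun h => hx (hv.tsupport_subset h)
      obtain ⟨z0, z1⟩ := eq_zero_of_notMem_tsupport hx'
      simp only [conjugatedDirac, z0, z1, (hzero x hx).2]
      simp [directional, tangential]

end TestFunctions

/-! ### Passage to `H¹₀` and absorption of the potential. -/

section Sobolev

theorem eLpNorm_two_sq {X F : Type*} [MeasurableSpace X] {μ : Measure X} [NormedAddCommGroup F]
    {f : X → F} (hf : MemLp f 2 μ) :
    eLpNorm f 2 μ ^ 2 = ENNReal.ofReal (∫ x, ‖f x‖ ^ 2 ∂μ) := by
  rw [hf.eLpNorm_eq_integral_rpow_norm (by simp) (by simp)]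
  have h0 : 0 ≤ ∫ x, ‖f x‖ ^ 2 ∂μ := integral_nonneg fun x => sq_nonneg _
  simp only [ENNReal.toReal_ofNat, Real.rpow_ofNat]
  rw [← ENNReal.ofReal_pow (Real.rpow_nonneg h0 _), ← Real.rpow_natCast, ← Real.rpow_mul h0]
  norm_num

theorem IsTestFunction.integrableOn_smul {F : Type*} [NormedAddCommGroup F] [NormedSpace ℝ F]
    {Ω : Set E3} {ψ : E3 → ℝ} (hψ : IsTestFunction Ω ψ)
    {g : E3 → F} (hg : LocallyIntegrableOn g Ω) : IntegrableOn (fun x => ψ x • g x) Ω := by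
  have h1 : IntegrableOn (fun x => ψ x • g x) (tsupport ψ) :=
    (hg.integrableOn_compact_subset hψ.tsupport_subset hψ.compactSupport).continuousOn_smul
      hψ.smooth.continuous.continuousOn hψ.compactSupport
  have h2 : Function.support (fun x => ψ x • g x) ⊆ tsupport ψ :=
    (Function.support_smul_subset_left ψ g).trans (subset_tsupport ψ)
  exact ((integrableOn_iff_integrable_of_support_subset h2).1 h1).integrableOn

theorem IsWeakPartialDeriv.ae_eq {F : Type*} [NormedAddCommGroup F] [NormedSpace ℝ F]
    [CompleteSpace F] {Ω : Set E3} (hΩ : IsOpen Ω) {j : Fin 3} {u g₁ g₂ : E3 → F}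
    (h₁ : IsWeakPartialDeriv Ω j u g₁) (h₂ : IsWeakPartialDeriv Ω j u g₂) :
    g₁ =ᵐ[volume.restrict Ω] g₂ := by
  have key := hΩ.ae_eq_zero_of_integral_contDiff_smul_eq_zero (μ := volume)
    (h₁.locallyIntegrable_deriv.sub h₂.locallyIntegrable_deriv) fun ψ hs hc ht => by
      have hψ : IsTestFunction Ω ψ := ⟨hs, hc, ht⟩
      have e : ∫ x in Ω, ψ x • g₁ x = ∫ x in Ω, ψ x • g₂ x :=
        neg_injective ((h₁.integral_eq ψ hψ).symm.trans (h₂.integral_eq ψ hψ))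
      rw [← setIntegral_eq_integral_of_forall_compl_eq_zero (s := Ω) fun x hx => by
        rw [(eq_zero_of_notMem_tsupport fun h => hx (ht h)).1, zero_smul]]
      simp only [Pi.sub_apply, smul_sub]
      rw [integral_sub (hψ.integrableOn_smul h₁.locallyIntegrable_deriv)
        (hψ.integrableOn_smul h₂.locallyIntegrable_deriv), e, sub_self]
  refine (ae_restrict_iff' hΩ.measurableSet).2 ?_
  filter_upwards [key] with x hx hxΩ
  exact sub_eq_zero.1 (hx hxΩ)

variable {V : Type*} [NormedAddCommGroup V] [InnerProductSpace ℝ V]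

theorem memLp_test {Ω : Set E3} {ψ : E3 → V} (hψ : IsTestFunction Ω ψ) :
    MemLp ψ 2 (volume.restrict Ω) :=
  hψ.smooth.continuous.memLp_of_hasCompactSupport hψ.compactSupport

theorem memLp_partialDeriv_test {Ω : Set E3} {ψ : E3 → V} (hψ : IsTestFunction Ω ψ) (j : Fin 3) :
    MemLp (partialDeriv j ψ) 2 (volume.restrict Ω) :=
  (hψ.smooth.partialDeriv j).continuous.memLp_of_hasCompactSupport
    (hψ.compactSupport.partialDeriv j)

section Weighted

variable {Ω : Set E3} {w : E3 → ℝ} {E : ℝ}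

theorem eLpNorm_weight_smul_le (hΩ : IsOpen Ω) (hE : ∀ x ∈ Ω, ‖w x‖ ≤ E) (f : E3 → V) :
    eLpNorm (fun x => w x • f x) 2 (volume.restrict Ω)
      ≤ ENNReal.ofReal E * eLpNorm f 2 (volume.restrict Ω) := by
  refine eLpNorm_le_mul_eLpNorm_of_ae_le_mul ?_ 2
  filter_upwards [ae_restrict_mem hΩ.measurableSet] with x hx
  rw [norm_smul]
  exact mul_le_mul_of_nonneg_right (hE x hx) (norm_nonneg _)

theorem aestronglyMeasurable_weight_smul (hΩ : IsOpen Ω) (hw : ContinuousOn w Ω) {f : E3 → V}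
    (hf : AEStronglyMeasurable f (volume.restrict Ω)) :
    AEStronglyMeasurable (fun x => w x • f x) (volume.restrict Ω) :=
  (hw.aestronglyMeasurable hΩ.measurableSet).smul hf

theorem memLp_weight_smul (hΩ : IsOpen Ω) (hw : ContinuousOn w Ω) (hE : ∀ x ∈ Ω, ‖w x‖ ≤ E)
    {f : E3 → V} (hf : MemLp f 2 (volume.restrict Ω)) :
    MemLp (fun x => w x • f x) 2 (volume.restrict Ω) :=
  ⟨aestronglyMeasurable_weight_smul hΩ hw hf.1,
    (eLpNorm_weight_smul_le hΩ hE f).trans_lt (ENNReal.mul_lt_top ENNReal.ofReal_lt_top hf.2)⟩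

theorem memLp_dirac (e : Fin 3 → V →L[ℝ] V) {D : Fin 3 → E3 → V}
    (hD : ∀ j, MemLp (D j) 2 (volume.restrict Ω)) :
    MemLp (fun x => ∑ m, e m (D m x)) 2 (volume.restrict Ω) :=
  memLp_finsetSum _ fun m _ => (e m).comp_memLp' (hD m)

/-- A weighted estimate for the free Dirac operator extends from test functions to `H¹₀`. -/
theorem MemH10.weighted_dirac_estimate [CompleteSpace V] {e : Fin 3 → V →L[ℝ] V}
    (he : IsCliffordTriple e) (hΩ : IsOpen Ω) (hw : ContinuousOn w Ω) (hE : ∀ x ∈ Ω, ‖w x‖ ≤ E)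
    {c : ℝ≥0∞} (hc : c ≠ ⊤)
    (htest : ∀ ψ : E3 → V, IsTestFunction Ω ψ →
      eLpNorm (fun x => w x • ψ x) 2 (volume.restrict Ω)
        ≤ c * eLpNorm (fun x => w x • ∑ m, e m (partialDeriv m ψ x)) 2 (volume.restrict Ω))
    {u : E3 → V} {du : Fin 3 → E3 → V} (hu : MemH10 Ω u)
    (hdu : ∀ j, IsWeakPartialDeriv Ω j u (du j)) :
    eLpNorm (fun x => w x • u x) 2 (volume.restrict Ω)
      ≤ c * eLpNorm (fun x => w x • ∑ m, e m (du m x)) 2 (volume.restrict Ω) := by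
  obtain ⟨huL, g, hg, happ⟩ := hu
  -- Weak derivatives are unique almost everywhere, so the given `du` may be replaced by the
  -- derivatives that the test functions approximate.
  have hgd : (fun x => w x • ∑ m, e m (du m x)) =ᵐ[volume.restrict Ω]
      fun x => w x • ∑ m, e m (g m x) := by
    have := ae_all_iff.2 fun j => (hdu j).ae_eq hΩ (hg j).2
    filter_upwards [this] with x hx
    simp only [hx]
  rw [eLpNorm_congr_ae hgd]
  -- Total amplification of an `H¹` error `δ`: the three derivatives on the right, then `u` itself
  -- on the left. Dividing by `K + 1` below avoids a zero denominator.
  set K : ℝ≥0∞ := c * (ENNReal.ofReal E * 3) + ENNReal.ofReal E with hK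
  have hKtop : K ≠ ⊤ := by
    refine ENNReal.add_ne_top.2 ⟨ENNReal.mul_ne_top hc (ENNReal.mul_ne_top ?_ ?_), ?_⟩ <;> simp
  refine ENNReal.le_of_forall_pos_le_add fun η hη _ => ?_
  obtain ⟨ψ, hψ, hψ0, hψ1⟩ := happ (η / (K + 1))
    (ENNReal.div_pos (by simpa using hη.ne') (ENNReal.add_ne_top.2 ⟨hKtop, by simp⟩))
  set δ : ℝ≥0∞ := η / (K + 1) with hδ
  have hKδ : K * δ ≤ η := calc
    K * δ ≤ (K + 1) * (η / (K + 1)) := by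
      rw [hδ]
      gcongr
      exact le_self_add
    _ ≤ η := ENNReal.mul_div_le
  have m1 := memLp_test hψ
  have m2 := memLp_partialDeriv_test hψ
  have split : eLpNorm (fun x => w x • u x) 2 (volume.restrict Ω)
      ≤ eLpNorm (fun x => w x • ψ x) 2 (volume.restrict Ω) + ENNReal.ofReal E * δ := by
    have : (fun x => w x • u x) = (fun x => w x • ψ x) + fun x => w x • (u x - ψ x) := by
      funext x
      simp [smul_sub]
    rw [this]
    refine (eLpNorm_add_le (aestronglyMeasurable_weight_smul hΩ hw m1.1)
      (aestronglyMeasurable_weight_smul hΩ hw (huL.sub m1).1) (by norm_num)).trans ?_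
    gcongr
    refine (eLpNorm_weight_smul_le hΩ hE _).trans ?_
    gcongr
    exact hψ0
  have hsum : eLpNorm (fun x => ∑ m, e m (partialDeriv m ψ x - g m x)) 2 (volume.restrict Ω)
      ≤ 3 * δ := by
    have hm : ∀ m, eLpNorm (fun x => e m (partialDeriv m ψ x - g m x)) 2 (volume.restrict Ω)
        ≤ δ := fun m => by
      refine le_trans (le_of_eq ?_) (hψ1 m)
      refine eLpNorm_congr_norm_ae (.of_forall fun x => ?_)
      rw [he.norm_apply, norm_sub_rev]
    have hs := eLpNorm_sum_le (p := 2) (s := Finset.univ) (μ := volume.restrict Ω)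
      (f := fun m x => e m (partialDeriv m ψ x - g m x))
      (fun m _ => ((e m).comp_memLp' ((m2 m).sub (hg m).1)).1) (by norm_num)
    have heq : (fun x => ∑ m, e m (partialDeriv m ψ x - g m x))
        = ∑ m, fun x => e m (partialDeriv m ψ x - g m x) := by
      funext x
      simp
    rw [heq]
    refine hs.trans ((Finset.sum_le_sum fun m _ => hm m).trans (le_of_eq ?_))
    simp
  have split' : eLpNorm (fun x => w x • ∑ m, e m (partialDeriv m ψ x)) 2 (volume.restrict Ω)
      ≤ eLpNorm (fun x => w x • ∑ m, e m (g m x)) 2 (volume.restrict Ω)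
        + ENNReal.ofReal E * (3 * δ) := by
    have : (fun x => w x • ∑ m, e m (partialDeriv m ψ x))
        = (fun x => w x • ∑ m, e m (g m x))
          + fun x => w x • ∑ m, e m (partialDeriv m ψ x - g m x) := by
      funext x
      simp [smul_sub]
    rw [this]
    refine (eLpNorm_add_le
      (aestronglyMeasurable_weight_smul hΩ hw (memLp_dirac e fun j => (hg j).1).1)
      (aestronglyMeasurable_weight_smul hΩ hw (memLp_dirac e fun j => (m2 j).sub (hg j).1).1)
      (by norm_num)).trans ?_
    gcongr
    refine (eLpNorm_weight_smul_le hΩ hE _).trans ?_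
    gcongr
    exact hsum
  calc _ ≤ _ := split
    _ ≤ c * (eLpNorm (fun x => w x • ∑ m, e m (g m x)) 2 (volume.restrict Ω)
          + ENNReal.ofReal E * (3 * δ)) + ENNReal.ofReal E * δ := by
        gcongr
        exact (htest ψ hψ).trans (by gcongr)
    _ = c * eLpNorm (fun x => w x • ∑ m, e m (g m x)) 2 (volume.restrict Ω) + K * δ := by
        rw [hK]
        ring
    _ ≤ _ := by gcongr

/-- Absorption of a bounded potential. -/
theorem absorb_le {a b c r : ℝ≥0∞} (ha : a ≠ ⊤) (h : a ≤ c * (b + r * a))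
    (hr : c * r ≤ 1 / 2) : a ≤ 2 * (c * b) := by
  have h1 : a / 2 + a / 2 ≤ c * b + a / 2 := by
    rw [ENNReal.add_halves]
    calc a ≤ c * b + c * r * a := by rw [mul_assoc, ← mul_add]; exact h
      _ ≤ c * b + 1 / 2 * a := by gcongr
      _ = c * b + a / 2 := by rw [one_div, ENNReal.div_eq_inv_mul]
  have h2 : a / 2 ≤ c * b :=
    ENNReal.le_of_add_le_add_right (ENNReal.div_ne_top ha (by simp)) h1
  calc a = 2 * (a / 2) := (ENNReal.mul_div_cancel (by simp) (by simp)).symm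
    _ ≤ _ := by gcongr

end Weighted

/-- Since `1 / ε(h) = C₀ α |log h|`, any threshold `K` is reached for small `h`; this is where `h₀`
acquires its dependence on `α`. -/
theorem inv_epsilon_ge {C₀ α h K : ℝ} (hC₀ : 0 < C₀) (hα : 0 < α) (hh : 0 < h)
    (hhK : h ≤ Real.exp (-(K / (C₀ * α)))) : K ≤ C₀ * |Real.log (h ^ α)| := by
  have hlog : Real.log h ≤ -(K / (C₀ * α)) := (Real.log_le_iff_le_exp hh).2 hhK
  have hCα : 0 < C₀ * α := mul_pos hC₀ hα
  rw [Real.log_rpow hh, abs_mul, abs_of_pos hα, ← mul_assoc]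
  calc K = C₀ * α * (K / (C₀ * α)) := by field_simp
    _ ≤ C₀ * α * |Real.log h| := by
        gcongr
        exact (le_neg.1 hlog).trans (neg_le_abs _)

theorem convexifiedWeight_div (φ : E3 → ℝ) (C₀ α : ℝ) {h : ℝ} (hh : 0 < h) (x : E3) :
    convexifiedWeight φ C₀ α h x / h
      = h⁻¹ * φ x + C₀ * |Real.log (h ^ α)| * (φ x ^ 2 / 2) := by
  rw [convexifiedWeight, epsilon, div_inv_eq_mul]
  field_simp

end Sobolev

end PauliDirac

end

/-! ### The Carleman estimate with potentials. -/

open PauliDirac in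
theorem lemma5p2
    (Ω : Set PauliDirac.E3) (hΩ_open : IsOpen Ω) (hΩ_bdd : Bornology.IsBounded Ω)
    (A : PauliDirac.E3 → PauliDirac.E3) (hA : ContDiffOn ℝ ∞ A (closure Ω))
    (q : PauliDirac.E3 → ℂ) (hq : ContDiffOn ℝ ∞ q (closure Ω))
    (φ : PauliDirac.E3 → ℝ)
    (hφ : PauliDirac.IsLimitingCarlemanWeightNear (closure Ω) φ)
    (C₀ : ℝ) (hC₀ : 0 < C₀) :
    ∃ C : ℝ, 0 < C ∧ ∀ α : ℝ, 0 < α → α < 1 →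
      ∃ h₀ : ℝ, 0 < h₀ ∧ ∀ h : ℝ, 0 < h → h ≤ h₀ →
        ∀ (u : PauliDirac.E3 → PauliDirac.Spinor)
          (du : Fin 3 → PauliDirac.E3 → PauliDirac.Spinor),
          PauliDirac.MemH10 Ω u →
          (∀ j, PauliDirac.IsWeakPartialDeriv Ω j u (du j)) →
          eLpNorm (fun x => Real.exp (PauliDirac.convexifiedWeight φ C₀ α h x / h) • u x)
              2 (volume.restrict Ω) ^ 2
            ≤ ENNReal.ofReal (C * PauliDirac.epsilon C₀ α h) *
              eLpNorm (fun x => Real.exp (PauliDirac.convexifiedWeight φ C₀ α h x / h) •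
                  PauliDirac.pauliDirac A q u du x)
                2 (volume.restrict Ω) ^ 2 := by
  obtain ⟨N, L, hL, hNL⟩ :=
    isCliffordTriple_pauliUnit.exists_carleman_testFunction hΩ_open hΩ_bdd hφ
  have hcomp := hΩ_bdd.isCompact_closure
  obtain ⟨MA, hMA⟩ := hcomp.exists_bound_of_continuousOn hA.continuousOn
  obtain ⟨Mq, hMq⟩ := hcomp.exists_bound_of_continuousOn hq.continuousOn
  set M := max MA Mq with hM
  have hφc : ContinuousOn φ (closure Ω) := by
    obtain ⟨U, -, hKU, hU⟩ := hφ
    exact hU.smooth.continuousOn.mono hKU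
  -- The free estimate has squared constant `2L/κ`; absorption doubles the norm bound, hence a
  -- factor `4` after squaring.
  refine ⟨8 * L, by positivity, fun α hα _ => ?_⟩
  -- The three thresholds ensure that `κ` is positive, that `κ - N ≥ κ / 2`, and that the potential,
  -- of size at most `4M`, satisfies `c * 4M ≤ 1/2`.
  set K : ℝ := max 1 (max (2 * N) (8 * L * (4 * M) ^ 2)) with hK
  refine ⟨Real.exp (-(K / (C₀ * α))), Real.exp_pos _, fun h hh hh₀ u du hu hdu => ?_⟩
  have hκK := inv_epsilon_ge hC₀ hα hh hh₀
  simp only [convexifiedWeight_div φ C₀ α hh, epsilon]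
  set κ : ℝ := C₀ * |Real.log (h ^ α)| with hκ
  have hκ1 : 1 ≤ κ := (le_max_left _ _).trans hκK
  have hκ2 : 2 * N ≤ κ := ((le_max_left _ _).trans (le_max_right _ _)).trans hκK
  have hκ3 : 8 * L * (4 * M) ^ 2 ≤ κ := ((le_max_right _ _).trans (le_max_right _ _)).trans hκK
  have hκ0 : 0 < κ := by linarith
  set w : E3 → ℝ := fun x => Real.exp (h⁻¹ * φ x + κ * (φ x ^ 2 / 2)) with hw
  have hwc : ContinuousOn w (closure Ω) := by fun_prop
  obtain ⟨E, hE⟩ := hcomp.exists_bound_of_continuousOn hwc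
  have hwΩ := hwc.mono (subset_closure (s := Ω))
  have hEΩ : ∀ x ∈ Ω, ‖w x‖ ≤ E := fun x hx => hE x (subset_closure hx)
  set c : ℝ≥0∞ := ENNReal.ofReal √(2 * L / κ) with hc
  have hc2 : c ^ 2 = ENNReal.ofReal (2 * L / κ) := by
    rw [hc, ← ENNReal.ofReal_pow (Real.sqrt_nonneg _), Real.sq_sqrt (by positivity)]
  have hfree := hu.weighted_dirac_estimate isCliffordTriple_pauliUnit hΩ_open hwΩ hEΩ
    (c := c) ENNReal.ofReal_ne_top (fun ψ hψ => by
      rw [← ENNReal.pow_le_pow_left_iff two_ne_zero, mul_pow, hc2,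
        eLpNorm_two_sq (memLp_weight_smul hΩ_open hwΩ hEΩ (memLp_test hψ)),
        eLpNorm_two_sq (memLp_weight_smul hΩ_open hwΩ hEΩ
          (memLp_dirac pauliUnit (memLp_partialDeriv_test hψ))),
        ← ENNReal.ofReal_mul (by positivity)]
      refine ENNReal.ofReal_le_ofReal ?_
      have h1 := hNL h⁻¹ κ ψ hψ
      have h0 : 0 ≤ ∫ x in Ω, ‖w x • ψ x‖ ^ 2 := integral_nonneg fun x => sq_nonneg _
      change (κ - N) * ∫ x in Ω, ‖w x • ψ x‖ ^ 2 ≤ _ at h1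
      rw [div_mul_eq_mul_div, le_div_iff₀ hκ0]
      change _ ≤ 2 * L * ∫ x in Ω, ‖w x • ∑ m, pauliUnit m (partialDeriv m ψ x)‖ ^ 2
      nlinarith) hdu
  have huL : MemLp (fun x => w x • u x) 2 (volume.restrict Ω) :=
    memLp_weight_smul hΩ_open hwΩ hEΩ hu.1
  have hdum : ∀ j, AEStronglyMeasurable (du j) (volume.restrict Ω) := fun j =>
    (hdu j).locallyIntegrable_deriv.aestronglyMeasurable
  have hRm : AEStronglyMeasurable (potentialTerm A q u) (volume.restrict Ω) := by
    have hAm : AEStronglyMeasurable A (volume.restrict Ω) :=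
      (hA.continuousOn.mono subset_closure).aestronglyMeasurable hΩ_open.measurableSet
    have hqm : AEStronglyMeasurable q (volume.restrict Ω) :=
      (hq.continuousOn.mono subset_closure).aestronglyMeasurable hΩ_open.measurableSet
    refine AEStronglyMeasurable.add ?_ (hqm.smul hu.1.1)
    refine Finset.aestronglyMeasurable_fun_sum _ fun j _ => ?_
    have hAj : AEStronglyMeasurable (fun x => ((A x j : ℝ) : ℂ)) (volume.restrict Ω) :=
      (Complex.continuous_ofReal.comp
        (EuclideanSpace.proj (𝕜 := ℝ) j).continuous).comp_aestronglyMeasurable hAm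
    have hσu : AEStronglyMeasurable (fun x => Matrix.toEuclideanLin (pauli j) (u x))
        (volume.restrict Ω) :=
      (Matrix.toEuclideanLin (pauli j)).continuous_of_finiteDimensional.comp_aestronglyMeasurable
        hu.1.1
    exact hAj.smul hσu
  have hsplit : eLpNorm (fun x => w x • ∑ m, pauliUnit m (du m x)) 2 (volume.restrict Ω)
      ≤ eLpNorm (fun x => w x • pauliDirac A q u du x) 2 (volume.restrict Ω)
        + ENNReal.ofReal (4 * M) * eLpNorm (fun x => w x • u x) 2 (volume.restrict Ω) := by
    have hDm : AEStronglyMeasurable (fun x => ∑ m, pauliUnit m (du m x)) (volume.restrict Ω) :=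
      Finset.aestronglyMeasurable_fun_sum _ fun m _ =>
        (pauliUnit m).continuous.comp_aestronglyMeasurable (hdum m)
    have hPm : AEStronglyMeasurable (fun x => pauliDirac A q u du x) (volume.restrict Ω) := by
      simp only [pauliDirac_eq]
      exact hRm.sub hDm
    have heq : (fun x => w x • ∑ m, pauliUnit m (du m x))
        = (fun x => w x • potentialTerm A q u x) - fun x => w x • pauliDirac A q u du x := by
      funext x
      simp [pauliDirac_eq, smul_sub]
    rw [heq, add_comm]
    refine (eLpNorm_sub_le (aestronglyMeasurable_weight_smul hΩ_open hwΩ hRm)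
      (aestronglyMeasurable_weight_smul hΩ_open hwΩ hPm) (by norm_num)).trans ?_
    gcongr
    refine eLpNorm_le_mul_eLpNorm_of_ae_le_mul ?_ 2
    filter_upwards [ae_restrict_mem hΩ_open.measurableSet] with x hx
    have hR := norm_potentialTerm_le (M := M)
      ((hMA x (subset_closure hx)).trans (le_max_left _ _))
      ((hMq x (subset_closure hx)).trans (le_max_right _ _)) u
    rw [norm_smul, norm_smul]
    calc ‖w x‖ * ‖potentialTerm A q u x‖ ≤ ‖w x‖ * (4 * M * ‖u x‖) := by gcongr
      _ = 4 * M * (‖w x‖ * ‖u x‖) := by ring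
  have hr : c * ENNReal.ofReal (4 * M) ≤ 1 / 2 := by
    rw [hc, ← ENNReal.ofReal_mul (Real.sqrt_nonneg _),
      show (1 / 2 : ℝ≥0∞) = ENNReal.ofReal (1 / 2) by
        rw [ENNReal.ofReal_div_of_pos two_pos]; simp]
    refine ENNReal.ofReal_le_ofReal (abs_le_of_sq_le_sq' ?_ (by norm_num)).2
    rw [mul_pow, Real.sq_sqrt (by positivity), div_mul_eq_mul_div, div_le_iff₀ hκ0]
    linarith
  -- Absorption subtracts half of the left side, so it needs `‖w u‖` to be finite; this holds
  -- because `w` is bounded on `Ω`.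
  have hfin := absorb_le huL.2.ne (hfree.trans (by gcongr)) hr
  calc _ ≤ (2 * (c * eLpNorm (fun x => w x • pauliDirac A q u du x) 2 (volume.restrict Ω))) ^ 2 :=
        ENNReal.pow_le_pow_left hfin
    _ = _ := by
        rw [mul_pow, mul_pow, hc2, ← mul_assoc, show (2 : ℝ≥0∞) ^ 2 = ENNReal.ofReal 4 by norm_num,
          ← ENNReal.ofReal_mul (by norm_num)]
        congr 2
        rw [← div_eq_mul_inv]
        ring
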